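/- **Setting.** Let $N\ge 2$, let $p_1,\dots,p_N\in\mathbb R^{N-1}$ satisfy $|p_i-p_j|=1$ for $i\ne j$, and put $F_i(x)=\frac12x+\frac12p_i$, $V_0=\{p_1,\dots,p_N\}$, $V_{m}=\bigcup_{i}F_i(V_{m-1})$ for $m\ge 1$. Let $V=\overline{\bigcup_m V_m}$ be the Sierpinski gasket. For $x,y\in V_m$ write $x\sim_m y$ if some cell $F_{w_1}\circ\dots\circ F_{w_m}(V)$, $w\in\{1,\dots,N\}^m$, contains both $x$ and $y$. For $u\in C(V)$ let $$W_m(u)=\tfrac12\Big(\tfrac{N+2}{N}\Big)^m\sum_{x,y\in V_m,\ x\sim_m y}(u(x)-u(y))^2,\qquad W(u)=\lim_{m\to\infty}W_m(u)\in[0,\infty]$$ (the sequence is increasing), and $H^1(V)=\{u\in C(V): W(u)<\infty\}$. Let $\mu$ be a finite Borel measure on $V$ such that every nonempty relatively open subset of $V$ has positive measure and $\mu(V_0)=0$. For $B=(B_1,\dots,B_N)$ with $B_i:\mathbb R\to[0,\infty]$ define $W_B:L^2_\mu(V)\to[0,\infty]$ by $W_B(u)=W(u)+\sum_{i=1}^N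 B_i(u(p_i))$ if $u\in H^1(V)$ and $W_B(u)=\infty$ otherwise. Let $W_{0}$ be the energy with all $B_i=0$ and $W_\infty$ the energy with $B_i(0)=0$, $B_i(s)=\infty$ for $s\ne0$. A strongly continuous semigroup $S=(S(t))_{t\ge0}$ of (possibly nonlinear) contractions on $L^2_\mu(V)$ is *generated* by an energy $\tilde W:L^2_\mu(V)\to[0,\infty]$ if for every $u_0\in L^2_\mu(V)$ the function $u(t)=S(t)u_0$ belongs to $C([0,\infty);L^2_\mu(V))\cap H^1_{loc}((0,\infty);L^2_\mu(V))$ and satisfies $u(0)=u_0$ and $\dot u+\partial\tilde W(u)\ni0$ almost everywhere on $(0,\infty)$, where $\partial\tilde W(u)=\{f:\tilde W(u+v)-\tilde W(u)\ge\langle f,v\rangle_{L^2_\mu}\ \forall v\}$ for $\tilde W(u)<\infty$, and $\partial\tilde W(u)=\emptyset$ otherwise. $S$ is *positive* if $S(t)u\ge0$ whenever $t\ge 0$, $u\ge0$, and *order preserving* if $S(t)u\le S(t)v$ whenever $t\ge 0$, $u\le v$. $S_1\preccurlyeq S_2$ means that $S_2$ is order preserving and $|S_1(t)u|\le S_2(t)v$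 whenever $t\ge 0$, $|u|\le v$; and $S_1\stackrel{t}{\preccurlyeq}S_2$ means $S_1\preccurlyeq S_2$ and $S_1\preccurlyeq -S_2(-\,\cdot\,)$. **Corollary 4.1.** Let $B_1,\dots,B_N:\mathbb R\to[0,\infty]$ be lower semicontinuous, bi-monotone (decreasing on $(-\infty,0]$ and increasing on $[0,\infty)$) and normalised ($B_i(0)=0$), and assume that $W_B$ is convex. Then each of $W_B$, $W_0$ and $W_\infty$ generates a unique strongly continuous semigroup of contractions on $L^2_\mu(V)$, denoted by $S_B$, $S$ and $S_\infty$, respectively; $S_B$ is positive and order preserving, and $$S_\infty\stackrel{t}{\preccurlyeq}S_B\stackrel{t}{\preccurlyeq}S .$$ -/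

import Mathlib

open MeasureTheory Filter Topology
open scoped NNReal ENNReal

noncomputable section

namespace Sierpinski

/-! ### The Sierpinski gasket -/

section Gasket

variable {E : Type*} [NormedAddCommGroup E] [NormedSpace ℝ E] {N : ℕ}

/-- The similarity `F_i(x) = x/2 + p_i/2`. -/
def similarity (p : Fin N → E) (i : Fin N) (x : E) : E :=
  (1 / 2 : ℝ) • x + (1 / 2 : ℝ) • p i

/-- `F_w = F_{w_1} ∘ ⋯ ∘ F_{w_m}` for a word `w = (w_1, …, w_m)`. -/
def wordMap (p : Fin N → E) : List (Fin N) → E → E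
  | [] => id
  | i :: w => similarity p i ∘ wordMap p w

open Classical in
/-- The vertex sets: `V_0 = {p_1, …, p_N}` and `V_{m+1} = ⋃ i, F_i(V_m)`. -/
def levelSet (p : Fin N → E) : ℕ → Finset E
  | 0 => Finset.univ.image p
  | m + 1 => Finset.univ.biUnion fun i => (levelSet p m).image (similarity p i)

/-- The Sierpinski gasket `V`, the closure of `V_* = ⋃ m, V_m`. -/
def gasket (p : Fin N → E) : Set E :=
  closure (⋃ m, (levelSet p m : Set E))

theorem levelSet_subset_gasket (p : Fin N → E) (m : ℕ) :
    (levelSet p m : Set E) ⊆ gasket p :=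
  (Set.subset_iUnion (fun m => (levelSet p m : Set E)) m).trans subset_closure

/-- The boundary vertex `p_i`, as a point of the gasket. -/
def vertex (p : Fin N → E) (i : Fin N) : gasket p :=
  ⟨p i, levelSet_subset_gasket p 0 (by simp [levelSet])⟩

/-- The intrinsic boundary `V_0`, as a subset of the gasket. -/
def boundary (p : Fin N → E) : Set (gasket p) :=
  Set.range (vertex p)

/-- `x ∼_m y`: some cell `F_w(V)` of level `m` contains both `x` and `y`. -/
def SameCell (p : Fin N → E) (m : ℕ) (x y : E) : Prop :=
  ∃ w : List (Fin N), w.length = m ∧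
    x ∈ wordMap p w '' gasket p ∧ y ∈ wordMap p w '' gasket p

open Classical in
/-- The vertices of level `m`, as points of the gasket. -/
def gasketLevel (p : Fin N → E) (m : ℕ) : Finset (gasket p) :=
  (levelSet p m).subtype (· ∈ gasket p)

open Classical in
/-- The `m`-energy `W_m(u)`; the sum is over ordered pairs `(x, y)` with `x ∼_m y`. -/
def levelEnergy (p : Fin N → E) (m : ℕ) (u : gasket p → ℝ) : ℝ :=
  1 / 2 * (((N : ℝ) + 2) / N) ^ m *
    ∑ x ∈ gasketLevel p m, ∑ y ∈ gasketLevel p m,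
      if SameCell p m x y then (u x - u y) ^ 2 else 0

/-- The energy `W(u) = lim_m W_m(u) ∈ [0, ∞]`. -/
def energy (p : Fin N → E) (u : gasket p → ℝ) : ℝ≥0∞ :=
  limUnder atTop fun m => ENNReal.ofReal (levelEnergy p m u)

/-- The space `H¹(V)` of continuous functions of finite energy. -/
def H1 (p : Fin N → E) : Set C(gasket p, ℝ) :=
  {u | energy p u < ⊤}

variable [MeasurableSpace E]

open Classical in
/-- The perturbed energy `W_B : L²_μ(V) → [0, ∞]`. A class `u` belongs to `H¹(V)` if it has a
representative there; the representative is unique if nonempty open sets have positive measure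
(see `perturbedEnergy_eq`). -/
def perturbedEnergy (p : Fin N → E) (μ : Measure (gasket p)) (B : Fin N → ℝ → ℝ≥0∞)
    (u : Lp ℝ 2 μ) : ℝ≥0∞ :=
  if h : ∃ g : C(gasket p, ℝ), g ∈ H1 p ∧ u =ᵐ[μ] g then
    energy p h.choose + ∑ i, B i (h.choose (vertex p i))
  else ⊤

theorem perturbedEnergy_eq (p : Fin N → E) (μ : Measure (gasket p)) [μ.IsOpenPosMeasure]
    (B : Fin N → ℝ → ℝ≥0∞) (u : Lp ℝ 2 μ) (g : C(gasket p, ℝ)) (hg : g ∈ H1 p)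
    (hu : u =ᵐ[μ] g) :
    perturbedEnergy p μ B u = energy p g + ∑ i, B i (g (vertex p i)) := by
  have h : ∃ g : C(gasket p, ℝ), g ∈ H1 p ∧ u =ᵐ[μ] g := ⟨g, hg, hu⟩
  have hc : h.choose = g := by
    apply DFunLike.coe_injective
    exact (Continuous.ae_eq_iff_eq μ h.choose.continuous g.continuous).1
      (h.choose_spec.2.symm.trans hu)
  unfold perturbedEnergy
  rw [dif_pos h, hc]

/-- The free (Neumann) energy: `W` on `H¹(V)`, extended to `L²_μ(V)` by `∞`. -/
def neumannEnergy (p : Fin N → E) (μ : Measure (gasket p)) : Lp ℝ 2 μ → ℝ≥0∞ :=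
  perturbedEnergy p μ fun _ _ => 0

open Classical in
/-- The Dirichlet energy `W_∞`: here `B_i(s) = ∞` for `s ≠ 0` and `B_i(0) = 0`. -/
def dirichletEnergy (p : Fin N → E) (μ : Measure (gasket p)) : Lp ℝ 2 μ → ℝ≥0∞ :=
  perturbedEnergy p μ fun _ s => if s = 0 then 0 else ⊤

end Gasket

/-- `f` is decreasing on `(-∞, 0]` and increasing on `[0, ∞)`. -/
def BiMonotone (f : ℝ → ℝ≥0∞) : Prop :=
  AntitoneOn f (Set.Iic 0) ∧ MonotoneOn f (Set.Ici 0)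

/-! ### Semigroups generated by convex energies -/

section Semigroup

variable {H : Type*} [NormedAddCommGroup H] [InnerProductSpace ℝ H]

/-- The subgradient `∂W(u) = {f | W(u + v) - W(u) ≥ ⟨f, v⟩ for all v}` at `u ∈ dom W`;
it is empty if `u ∉ dom W`. -/
def subgradient (W : H → ℝ≥0∞) (u : H) : Set H :=
  {f | W u < ⊤ ∧ ∀ v : H, (W u : EReal) + ((inner ℝ f v : ℝ) : EReal) ≤ (W (u + v) : EReal)}

/-- `u ∈ C([0, ∞); H) ∩ H¹_loc((0, ∞); H)`, with derivative `g`, solves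
`u' + ∂W(u) ∋ 0` almost everywhere on `(0, ∞)` and `u(0) = u₀`. -/
def IsStrongSolution (W : H → ℝ≥0∞) (u₀ : H) (u : ℝ≥0 → H) : Prop :=
  Continuous u ∧ u 0 = u₀ ∧
  ∃ g : ℝ → H,
    (∀ a b : ℝ≥0, 0 < a → a ≤ b →
      MemLp g 2 (volume.restrict (Set.Icc (a : ℝ) b)) ∧
      u b - u a = ∫ τ in (a : ℝ)..b, g τ) ∧
    ∀ᵐ τ ∂(volume.restrict (Set.Ioi (0 : ℝ))), -g τ ∈ subgradient W (u τ.toNNReal)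

/-- A strongly continuous semigroup of (possibly nonlinear) contractions on `H`. -/
@[ext]
structure ContractionSemigroup (H : Type*) [NormedAddCommGroup H] where
  toFun : ℝ≥0 → H → H
  map_zero' : ∀ u, toFun 0 u = u
  map_add' : ∀ s t u, toFun (s + t) u = toFun s (toFun t u)
  continuous' : ∀ u, Continuous fun t => toFun t u
  contraction' : ∀ t u v, ‖toFun t u - toFun t v‖ ≤ ‖u - v‖

instance (H : Type*) [NormedAddCommGroup H] :
    CoeFun (ContractionSemigroup H) fun _ => ℝ≥0 → H → H :=
  ⟨ContractionSemigroup.toFun⟩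

/-- The semigroup `S` on the whole space `H` is generated by the energy `W`: each orbit
`t ↦ S(t)u₀` is a strong solution of `u' + ∂W(u) ∋ 0`, `u(0) = u₀`. -/
def Generates (W : H → ℝ≥0∞) (S : ContractionSemigroup H) : Prop :=
  ∀ u₀ : H, IsStrongSolution W u₀ fun t => S t u₀

end Semigroup

/-! ### Order properties of families of operators on `L²` -/

section Order

variable {X : Type*} [MeasurableSpace X] {μ : Measure X}

def IsPositive (S : ℝ≥0 → Lp ℝ 2 μ → Lp ℝ 2 μ) : Prop :=
  ∀ t u, 0 ≤ u → 0 ≤ S t u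

def OrderPreserving (S : ℝ≥0 → Lp ℝ 2 μ → Lp ℝ 2 μ) : Prop :=
  ∀ t u v, u ≤ v → S t u ≤ S t v

/-- `S₁ ≼ S₂`. -/
def DominatedBy (S₁ S₂ : ℝ≥0 → Lp ℝ 2 μ → Lp ℝ 2 μ) : Prop :=
  OrderPreserving S₂ ∧ ∀ t u v, |u| ≤ v → |S₁ t u| ≤ S₂ t v

/-- `S₁ ≼ᵗ S₂`, that is, `S₁ ≼ S₂` and `S₁ ≼ -S₂(-·)`. -/
def TotallyDominatedBy (S₁ S₂ : ℝ≥0 → Lp ℝ 2 μ → Lp ℝ 2 μ) : Prop :=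
  DominatedBy S₁ S₂ ∧ DominatedBy S₁ fun t u => -S₂ t (-u)

end Order

end Sierpinski

end

/-!
For a convex, lower semicontinuous, densely defined energy the implicit Euler steps are contractions
obeying a discrete evolution variational inequality. The scheme therefore converges along dyadic
step sizes, its limit obeys the continuous inequality, and the latter makes the limit a strong
solution; monotonicity of the subgradient gives uniqueness.

Order properties are inherited from a single step. If the pair `(a, b)` of minimisers belonging to
the data `(u, v)` can be exchanged for a pair `(a', b')` without increasing the sum of the energies
or the sum of the squared distances to the data, then `a' = a` and `b' = b`, as minimisers are
unique. The exchange for `(a ⊓ b, a ⊔ b)` gives order preservation, and the one for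
`((a ⊓ b) ⊔ -b, |a| ⊔ b)` gives domination. On the gasket both exchanges act edge by edge, so they
only have to be verified for the boundary terms.

It remains to see that the energies are lower semicontinuous and densely defined. Functions of
bounded energy oscillate on cells of level `m` by `O((N / (N + 2)) ^ (m / 2))`, hence are
equicontinuous, so that an `L²`-limit of them is a pointwise limit of continuous representatives.
Conversely, harmonic extension produces functions of finite energy with prescribed values on `V_m`,
and by the maximum principle these approximate continuous functions uniformly.
-/

noncomputable section

namespace Sierpinski

section StrongConvexity

variable {E : Type*} [NormedAddCommGroup E] [NormedSpace ℝ E] {s : Set E} {f : E → ℝ} {m c : ℝ}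

theorem quadratic_growth_of_isMinOn (hf : StrongConvexOn s m f) {z v : E} (hz : z ∈ s)
    (hmin : IsMinOn f s z) (hv : v ∈ s) : f z + m / 2 * ‖z - v‖ ^ 2 ≤ f v := by
  have segment_le : ∀ᶠ θ : ℝ in 𝓝[>] 0, f z + (1 - θ) * (m / 2 * ‖z - v‖ ^ 2) ≤ f v := by
    filter_upwards [Ioo_mem_nhdsGT zero_lt_one] with θ ⟨hθ₀, hθ₁⟩
    have hconv := hf.2 hz hv (sub_nonneg.2 hθ₁.le) hθ₀.le (sub_add_cancel 1 θ)
    have hle := isMinOn_iff.1 hmin _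
      (hf.1 hz hv (sub_nonneg.2 hθ₁.le) hθ₀.le (sub_add_cancel 1 θ))
    simp only [smul_eq_mul] at hconv
    exact le_of_mul_le_mul_left (by linarith) hθ₀
  have hlim : Tendsto (fun θ : ℝ => f z + (1 - θ) * (m / 2 * ‖z - v‖ ^ 2)) (𝓝[>] 0)
      (𝓝 (f z + (1 - 0) * (m / 2 * ‖z - v‖ ^ 2))) :=
    tendsto_nhdsWithin_of_tendsto_nhds (Continuous.tendsto (by fun_prop) 0)
  simpa using le_of_tendsto hlim segment_le

theorem norm_sub_sq_le_of_almost_min (hf : StrongConvexOn s m f) (hc : ∀ v ∈ s, c ≤ f v)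
    {u v : E} (hu : u ∈ s) (hv : v ∈ s) :
    m / 4 * ‖u - v‖ ^ 2 ≤ (f u - c) + (f v - c) := by
  have half_nonneg : (0 : ℝ) ≤ 1 / 2 := one_half_pos.le
  have hmid := hf.2 hu hv half_nonneg half_nonneg (add_halves 1)
  have hle := hc _ (hf.1 hu hv half_nonneg half_nonneg (add_halves 1))
  simp only [smul_eq_mul] at hmid
  linarith

theorem cauchySeq_of_strongConvexOn (hf : StrongConvexOn s m f) (hm : 0 < m)
    (hc : ∀ v ∈ s, c ≤ f v) {v : ℕ → E} (hv : ∀ n, v n ∈ s)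
    (hlim : Tendsto (fun n => f (v n)) atTop (𝓝 c)) : CauchySeq v := by
  refine Metric.cauchySeq_iff.2 fun ε hε => ?_
  obtain ⟨K, hK⟩ := eventually_atTop.1
    (hlim.eventually (gt_mem_nhds (show c < c + m / 8 * ε ^ 2 from lt_add_of_pos_right c (by
      positivity))))
  refine ⟨K, fun k hk n hn => ?_⟩
  have hsq := norm_sub_sq_le_of_almost_min hf hc (hv k) (hv n)
  rw [dist_eq_norm]
  refine lt_of_pow_lt_pow_left₀ 2 hε.le (lt_of_mul_lt_mul_left ?_ (by positivity : 0 ≤ m / 4))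
  linarith [hK k hk, hK n hn]

theorem exists_isMinOn_of_strongConvexOn [CompleteSpace E] (hf : StrongConvexOn s m f)
    (hm : 0 < m) (hs : s.Nonempty) (hbdd : BddBelow (f '' s))
    (hclosed : IsClosed {q : E × ℝ | q.1 ∈ s ∧ f q.1 ≤ q.2}) : ∃ z ∈ s, IsMinOn f s z := by
  obtain ⟨r, -, hr, hrs⟩ := exists_seq_tendsto_sInf (hs.image f) hbdd
  choose v hv hvr using hrs
  obtain rfl : (fun n => f (v n)) = r := funext hvr
  have hle : ∀ u ∈ s, sInf (f '' s) ≤ f u := fun u hu => csInf_le hbdd ⟨u, hu, rfl⟩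
  obtain ⟨z, hz⟩ := cauchySeq_tendsto_of_complete (cauchySeq_of_strongConvexOn hf hm hle hv hr)
  obtain ⟨hzs, hfz⟩ := hclosed.mem_of_tendsto (hz.prodMk_nhds hr)
    (Eventually.of_forall fun n => ⟨hv n, le_rfl⟩)
  exact ⟨z, hzs, isMinOn_iff.2 fun u hu => hfz.trans (hle u hu)⟩

end StrongConvexity

section Resolvent

variable {H : Type*} [NormedAddCommGroup H] {W : H → ℝ≥0∞} {τ : ℝ}

/-- The functional `2τ W + ‖· - x‖²` whose minimiser is the implicit Euler step of size `τ` from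
`x`. At points with `W v = ⊤` its value is meaningless. -/
def proxObjective (W : H → ℝ≥0∞) (τ : ℝ) (x v : H) : ℝ :=
  2 * τ * (W v).toReal + ‖v - x‖ ^ 2

/-- `z` is the implicit Euler step of size `τ` from `x`, that is `z = argmin (2τ W + ‖· - x‖²)`.
The minimality is encoded by the discrete evolution variational inequality, which is equivalent to
it for convex `W`. -/
def IsProx (W : H → ℝ≥0∞) (τ : ℝ) (x z : H) : Prop :=
  W z ≠ ⊤ ∧ ∀ v, W v ≠ ⊤ →
    ‖z - v‖ ^ 2 ≤ ‖x - v‖ ^ 2 - ‖z - x‖ ^ 2 + 2 * τ * ((W v).toReal - (W z).toReal)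

theorem IsProx.toReal_le {x z : H} (hτ : 0 < τ) (h : IsProx W τ x z) (hx : W x ≠ ⊤) :
    (W z).toReal ≤ (W x).toReal := by
  have hx := h.2 x hx
  rw [sub_self, norm_zero] at hx
  refine sub_nonneg.1 (nonneg_of_mul_nonneg_right ?_ (mul_pos two_pos hτ))
  linarith [sq_nonneg ‖z - x‖]

open Classical in
/-- The resolvent `(1 + τ ∂W)⁻¹`; junk where the implicit Euler step does not exist. -/
def resolvent (W : H → ℝ≥0∞) (τ : ℝ) (x : H) : H :=
  if h : ∃ z, IsProx W τ x z then h.choose else x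

variable [InnerProductSpace ℝ H]

/-- A convex, lower semicontinuous and densely defined energy: the class of functionals that
generate a contraction semigroup on all of `H`. -/
structure IsConvexEnergy (W : H → ℝ≥0∞) : Prop where
  convex : ConvexOn ℝ≥0 Set.univ W
  lsc : LowerSemicontinuous W
  dense : Dense {u | W u ≠ ⊤}

theorem IsConvexEnergy.convexOn_toReal (hW : IsConvexEnergy W) :
    ConvexOn ℝ {u | W u ≠ ⊤} fun u => (W u).toReal := by
  have key : ∀ ⦃u⦄, W u ≠ ⊤ → ∀ ⦃v⦄, W v ≠ ⊤ → ∀ ⦃a b : ℝ⦄, 0 ≤ a → 0 ≤ b → a + b = 1 →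
      W (a • u + b • v) ≤ ENNReal.ofReal (a * (W u).toReal + b * (W v).toReal) := by
    intro u hu v hv a b ha hb hab
    lift a to ℝ≥0 using ha
    lift b to ℝ≥0 using hb
    refine (hW.convex.2 (Set.mem_univ u) (Set.mem_univ v) a.2 b.2 (by exact_mod_cast hab)).trans_eq
      ?_
    rw [ENNReal.ofReal_add (by positivity) (by positivity), ENNReal.ofReal_mul a.coe_nonneg,
      ENNReal.ofReal_mul b.coe_nonneg, ENNReal.ofReal_toReal hu, ENNReal.ofReal_toReal hv,
      ENNReal.ofReal_coe_nnreal, ENNReal.ofReal_coe_nnreal]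
    rfl
  refine ⟨fun u hu v hv a b ha hb hab =>
    ne_top_of_le_ne_top ENNReal.ofReal_ne_top (key hu hv ha hb hab),
    fun u hu v hv a b ha hb hab => ENNReal.toReal_le_of_le_ofReal ?_ (key hu hv ha hb hab)⟩
  positivity

theorem IsConvexEnergy.isClosed_epigraph (hW : IsConvexEnergy W) :
    IsClosed {q : H × ℝ | W q.1 ≠ ⊤ ∧ (W q.1).toReal ≤ q.2} := by
  have epigraph_eq : {q : H × ℝ | W q.1 ≠ ⊤ ∧ (W q.1).toReal ≤ q.2} =
      (fun q => (q.1, ENNReal.ofReal q.2)) ⁻¹' {q : H × ℝ≥0∞ | W q.1 ≤ q.2} ∩ {q | 0 ≤ q.2} := by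
    ext ⟨u, r⟩
    refine ⟨fun ⟨hu, hr⟩ => ⟨(ENNReal.le_ofReal_iff_toReal_le hu
      (ENNReal.toReal_nonneg.trans hr)).2 hr, ENNReal.toReal_nonneg.trans hr⟩, fun ⟨hu, hr⟩ => ?_⟩
    exact ⟨ne_top_of_le_ne_top ENNReal.ofReal_ne_top hu, ENNReal.toReal_le_of_le_ofReal hr hu⟩
  rw [epigraph_eq]
  exact (hW.lsc.isClosed_epigraph.preimage
    (continuous_fst.prodMk (ENNReal.continuous_ofReal.comp continuous_snd))).inter
    (isClosed_le continuous_const continuous_snd)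

theorem IsConvexEnergy.strongConvexOn_proxObjective (hW : IsConvexEnergy W) (hτ : 0 ≤ τ) (x : H) :
    StrongConvexOn {v | W v ≠ ⊤} 2 (proxObjective W τ x) := by
  have hlin : ConvexOn ℝ {v | W v ≠ ⊤} fun v => -(2 * inner ℝ x v) + ‖x‖ ^ 2 :=
    ((-((2 : ℝ) • innerₗ H x)).convexOn hW.convexOn_toReal.1).add_const (‖x‖ ^ 2)
  rw [strongConvexOn_iff_convex]
  refine ((hW.convexOn_toReal.smul (by positivity : 0 ≤ 2 * τ)).add hlin).congr fun v _ => ?_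
  simp only [proxObjective, norm_sub_sq_real, real_inner_comm x v, Pi.add_apply, smul_eq_mul]
  ring

theorem IsConvexEnergy.isClosed_epigraph_proxObjective (hW : IsConvexEnergy W) (hτ : 0 < τ)
    (x : H) : IsClosed {q : H × ℝ | W q.1 ≠ ⊤ ∧ proxObjective W τ x q.1 ≤ q.2} := by
  have hcont : Continuous fun q : H × ℝ => (q.1, (q.2 - ‖q.1 - x‖ ^ 2) / (2 * τ)) := by fun_prop
  convert hW.isClosed_epigraph.preimage hcont using 1
  ext q
  simp only [proxObjective, Set.mem_ofPred_eq, Set.mem_preimage, le_div_iff₀' (mul_pos two_pos hτ),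
    le_sub_iff_add_le]

theorem IsConvexEnergy.exists_isProx [CompleteSpace H] (hW : IsConvexEnergy W) (hτ : 0 < τ)
    (x : H) : ∃ z, IsProx W τ x z := by
  have hbdd : BddBelow (proxObjective W τ x '' {v | W v ≠ ⊤}) :=
    ⟨0, by rintro _ ⟨v, -, rfl⟩; unfold proxObjective; positivity⟩
  have hstrong := hW.strongConvexOn_proxObjective hτ.le x
  obtain ⟨z, hz, hmin⟩ := exists_isMinOn_of_strongConvexOn hstrong two_pos hW.dense.nonempty hbdd
    (hW.isClosed_epigraph_proxObjective hτ x)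
  refine ⟨z, hz, fun v hv => ?_⟩
  have hgrowth := quadratic_growth_of_isMinOn hstrong hz hmin hv
  simp only [proxObjective] at hgrowth
  rw [norm_sub_rev x v]
  linarith

theorem IsProx.norm_sub_le {x x' z z' : H} (h : IsProx W τ x z) (h' : IsProx W τ x' z') :
    ‖z - z'‖ ≤ ‖x - x'‖ := by
  have hsum : ‖z - z'‖ ^ 2 ≤ inner ℝ (x - x') (z - z') := by
    have hz := h.2 z' h'.1
    have hz' := h'.2 z h.1
    simp only [norm_sub_sq_real, inner_sub_left, inner_sub_right, real_inner_comm] at hz hz' ⊢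
    linarith
  have hcs : ‖z - z'‖ * ‖z - z'‖ ≤ ‖x - x'‖ * ‖z - z'‖ :=
    (pow_two _).symm.trans_le (hsum.trans (real_inner_le_norm _ _))
  rcases (norm_nonneg (z - z')).eq_or_lt with h0 | h0
  · exact h0 ▸ norm_nonneg _
  · exact le_of_mul_le_mul_right hcs h0

theorem IsProx.eq {x z z' : H} (h : IsProx W τ x z) (h' : IsProx W τ x z') : z = z' := by
  simpa [sub_eq_zero] using h.norm_sub_le h'

theorem IsProx.resolvent_eq {x z : H} (h : IsProx W τ x z) : resolvent W τ x = z := by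
  have hex : ∃ z, IsProx W τ x z := ⟨z, h⟩
  rw [resolvent, dif_pos hex]
  exact hex.choose_spec.eq h

theorem IsConvexEnergy.isProx_resolvent [CompleteSpace H] (hW : IsConvexEnergy W) (hτ : 0 < τ)
    (x : H) : IsProx W τ x (resolvent W τ x) := by
  obtain ⟨z, hz⟩ := hW.exists_isProx hτ x
  rwa [hz.resolvent_eq]

end Resolvent

section ImplicitEuler

theorem cauchySeq_apply_of_dense {X Y : Type*} [PseudoMetricSpace X] [PseudoMetricSpace Y]
    {f : ℕ → X → Y} (hf : ∀ k, LipschitzWith 1 (f k)) {s : Set X} (hs : Dense s)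
    (hcauchy : ∀ y ∈ s, CauchySeq fun k => f k y) (x : X) : CauchySeq fun k => f k x := by
  refine Metric.cauchySeq_iff.2 fun ε hε => ?_
  obtain ⟨y, hyx, hys⟩ := Metric.dense_iff.1 hs x (ε / 3) (by positivity)
  obtain ⟨K, hK⟩ := Metric.cauchySeq_iff.1 (hcauchy y hys) (ε / 3) (by positivity)
  have close : ∀ k, dist (f k x) (f k y) < ε / 3 := fun k =>
    (hf k).dist_le_mul x y |>.trans_lt (by simpa [dist_comm] using hyx)
  refine ⟨K, fun m hm n hn => (dist_triangle4 _ (f m y) (f n y) _).trans_lt ?_⟩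
  linarith [close m, close n, hK m hm n hn, dist_comm (f n x) (f n y)]

theorem exists_floor_add_eq {a b : ℝ} (ha : 0 ≤ a) (hb : 0 ≤ b) :
    ∃ e ≤ 1, ⌊a + b⌋₊ = e + (⌊a⌋₊ + ⌊b⌋₊) := by
  have le_floor : ⌊a⌋₊ + ⌊b⌋₊ ≤ ⌊a + b⌋₊ :=
    Nat.le_floor (by push_cast; exact add_le_add (Nat.floor_le ha) (Nat.floor_le hb))
  have floor_lt : ⌊a + b⌋₊ < ⌊a⌋₊ + ⌊b⌋₊ + 2 := (Nat.floor_lt (by positivity)).2 (by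
    push_cast; linarith [Nat.lt_floor_add_one a, Nat.lt_floor_add_one b])
  exact ⟨⌊a + b⌋₊ - (⌊a⌋₊ + ⌊b⌋₊), by omega, by omega⟩

theorem sqrt_pow {x : ℝ} (hx : 0 ≤ x) (k : ℕ) : √(x ^ k) = √x ^ k := by
  rw [Real.sqrt_eq_iff_mul_self_eq (by positivity) (by positivity), ← mul_pow,
    Real.mul_self_sqrt hx]

variable {H : Type*} [NormedAddCommGroup H] [InnerProductSpace ℝ H] [CompleteSpace H]
  {W : H → ℝ≥0∞} {τ : ℝ} {x v : H}

theorem IsConvexEnergy.lipschitzWith_resolvent (hW : IsConvexEnergy W) (hτ : 0 < τ) :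
    LipschitzWith 1 (resolvent W τ) :=
  .mk_one fun x y => by
    simpa only [dist_eq_norm] using
      (hW.isProx_resolvent hτ x).norm_sub_le (hW.isProx_resolvent hτ y)

theorem IsConvexEnergy.iterate_resolvent_ne_top (hW : IsConvexEnergy W) (hτ : 0 < τ)
    (hx : W x ≠ ⊤) (n : ℕ) : W ((resolvent W τ)^[n] x) ≠ ⊤ := by
  cases n with
  | zero => exact hx
  | succ n =>
    rw [Function.iterate_succ_apply']
    exact (hW.isProx_resolvent hτ _).1

theorem IsConvexEnergy.toReal_iterate_resolvent_le (hW : IsConvexEnergy W) (hτ : 0 < τ)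
    (hx : W x ≠ ⊤) (n : ℕ) : (W ((resolvent W τ)^[n] x)).toReal ≤ (W x).toReal := by
  induction n with
  | zero => rfl
  | succ n ih =>
    rw [Function.iterate_succ_apply']
    exact ((hW.isProx_resolvent hτ _).toReal_le hτ (hW.iterate_resolvent_ne_top hτ hx n)).trans ih

theorem IsConvexEnergy.norm_iterate_resolvent_sub_sq_le (hW : IsConvexEnergy W) (hτ : 0 < τ)
    (n : ℕ) (x : H) (hv : W v ≠ ⊤) :
    ‖(resolvent W τ)^[n] x - v‖ ^ 2 ≤
      ‖x - v‖ ^ 2 + 2 * (n * τ) * ((W v).toReal - (W ((resolvent W τ)^[n] x)).toReal) := by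
  induction n generalizing x with
  | zero => simp
  | succ n ih =>
    rw [Function.iterate_succ_apply]
    have hprox := hW.isProx_resolvent hτ x
    have hdecr := mul_le_mul_of_nonneg_left (hW.toReal_iterate_resolvent_le hτ hprox.1 n) hτ.le
    push_cast
    linarith [ih (resolvent W τ x), hprox.2 v hv, sq_nonneg ‖resolvent W τ x - x‖]

theorem IsConvexEnergy.norm_iterate_resolvent_add_sub_sq_le (hW : IsConvexEnergy W) (hτ : 0 < τ)
    (n m : ℕ) (hx : W x ≠ ⊤) :
    ‖(resolvent W τ)^[n + m] x - (resolvent W τ)^[m] x‖ ^ 2 ≤ 2 * (n * τ) * (W x).toReal := by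
  rw [Function.iterate_add_apply]
  refine (hW.norm_iterate_resolvent_sub_sq_le hτ n _ (hW.iterate_resolvent_ne_top hτ hx m)).trans ?_
  rw [sub_self, norm_zero, zero_pow two_ne_zero, zero_add]
  gcongr
  exact (sub_le_self _ ENNReal.toReal_nonneg).trans (hW.toReal_iterate_resolvent_le hτ hx m)

theorem IsConvexEnergy.norm_iterate_resolvent_half_sub_sq_le (hW : IsConvexEnergy W) (hτ : 0 < τ)
    (n : ℕ) (hx : W x ≠ ⊤) :
    ‖(resolvent W (τ / 2))^[2 * n] x - (resolvent W τ)^[n] x‖ ^ 2 ≤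
      2 * τ * ((W x).toReal - (W ((resolvent W (τ / 2))^[2 * n] x)).toReal) := by
  have hτ₂ : 0 < τ / 2 := half_pos hτ
  induction n with
  | zero => simp
  | succ n ih =>
    rw [show 2 * (n + 1) = 2 + 2 * n by ring, Function.iterate_add_apply,
      Function.iterate_succ_apply' (resolvent W τ)]
    set y := (resolvent W (τ / 2))^[2 * n] x
    set z := (resolvent W τ)^[n] x
    have hz := hW.isProx_resolvent hτ z
    have hfine := hW.norm_iterate_resolvent_sub_sq_le hτ₂ 2 y hz.1
    have hcoarse := hz.2 y (hW.iterate_resolvent_ne_top hτ₂ hx _)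
    rw [norm_sub_rev z y, norm_sub_rev _ y] at hcoarse
    push_cast at hfine
    linarith [sq_nonneg ‖resolvent W τ z - z‖]

end ImplicitEuler

section Flow

/-- The last multiple of `2⁻ᵏ` before `t`. -/
def dyadicFloor (k : ℕ) (t : ℝ≥0) : ℝ :=
  ⌊(t : ℝ) * 2 ^ k⌋₊ * (1 / 2) ^ k

theorem tendsto_dyadicFloor (t : ℝ≥0) :
    Tendsto (fun k => dyadicFloor k t) atTop (𝓝 (t : ℝ)) := by
  refine ((tendsto_nat_floor_mul_div_atTop (R := ℝ) t.coe_nonneg).comp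
    (tendsto_pow_atTop_atTop_of_one_lt (one_lt_two (α := ℝ)))).congr fun k => ?_
  simp [dyadicFloor, div_eq_mul_inv]

variable {H : Type*} [NormedAddCommGroup H]

/-- The implicit Euler scheme for `u' + ∂W(u) ∋ 0`, with step size `2⁻ᵏ`. -/
def euler (W : H → ℝ≥0∞) (k : ℕ) (t : ℝ≥0) (x : H) : H :=
  (resolvent W ((1 / 2) ^ k))^[⌊(t : ℝ) * 2 ^ k⌋₊] x

/-- The gradient flow of `W`, as the limit of the implicit Euler scheme. -/
def flow (W : H → ℝ≥0∞) (t : ℝ≥0) (x : H) : H :=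
  limUnder atTop fun k => euler W k t x

theorem exists_euler_eq_iterate (W : H → ℝ≥0∞) {s t : ℝ≥0} (hst : s ≤ t) (k : ℕ) (x : H) :
    ∃ n : ℕ, euler W k t x = (resolvent W ((1 / 2) ^ k))^[n] (euler W k s x) ∧
      n * (1 / 2) ^ k = dyadicFloor k t - dyadicFloor k s := by
  have hfloor : ⌊(s : ℝ) * 2 ^ k⌋₊ ≤ ⌊(t : ℝ) * 2 ^ k⌋₊ := by gcongr
  refine ⟨⌊(t : ℝ) * 2 ^ k⌋₊ - ⌊(s : ℝ) * 2 ^ k⌋₊, ?_, ?_⟩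
  · rw [euler, euler, ← Function.iterate_add_apply, Nat.sub_add_cancel hfloor]
  · rw [Nat.cast_sub hfloor, sub_mul, dyadicFloor, dyadicFloor]

variable [InnerProductSpace ℝ H] [CompleteSpace H] {W : H → ℝ≥0∞} {s t : ℝ≥0} {x v : H}

theorem IsConvexEnergy.lipschitzWith_euler (hW : IsConvexEnergy W) (k : ℕ) (t : ℝ≥0) :
    LipschitzWith 1 (euler W k t) := by
  simpa only [one_pow] using! (hW.lipschitzWith_resolvent (by positivity)).iterate _

theorem IsConvexEnergy.norm_euler_succ_sub_le (hW : IsConvexEnergy W) (k : ℕ) (t : ℝ≥0)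
    (hx : W x ≠ ⊤) :
    ‖euler W (k + 1) t x - euler W k t x‖ ≤ 2 * √(2 * (W x).toReal) * √(1 / 2) ^ k := by
  have hτ : (0 : ℝ) < (1 / 2) ^ k := by positivity
  set n := ⌊(t : ℝ) * 2 ^ k⌋₊
  obtain ⟨e, he, hfloor⟩ := exists_floor_add_eq (a := t * 2 ^ k) (b := t * 2 ^ k)
    (by positivity) (by positivity)
  have euler_succ : euler W (k + 1) t x = (resolvent W ((1 / 2) ^ k / 2))^[e + 2 * n] x := by
    rw [euler, pow_succ, pow_succ, ← mul_assoc, mul_two, hfloor, ← two_mul, mul_one_div]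
  have rounding : ‖euler W (k + 1) t x - (resolvent W ((1 / 2) ^ k / 2))^[2 * n] x‖ ≤
      √(2 * (1 / 2) ^ k * (W x).toReal) := by
    refine Real.le_sqrt_of_sq_le (euler_succ ▸
      (hW.norm_iterate_resolvent_add_sub_sq_le (half_pos hτ) e _ hx).trans ?_)
    have he' : (e : ℝ) ≤ 1 := by exact_mod_cast he
    gcongr
    nlinarith
  have refinement : ‖(resolvent W ((1 / 2) ^ k / 2))^[2 * n] x - euler W k t x‖ ≤
      √(2 * (1 / 2) ^ k * (W x).toReal) := by
    refine Real.le_sqrt_of_sq_le ((hW.norm_iterate_resolvent_half_sub_sq_le hτ n hx).trans ?_)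
    gcongr
    exact sub_le_self _ ENNReal.toReal_nonneg
  calc ‖euler W (k + 1) t x - euler W k t x‖
      ≤ √(2 * (1 / 2) ^ k * (W x).toReal) + √(2 * (1 / 2) ^ k * (W x).toReal) :=
        (norm_sub_le_norm_sub_add_norm_sub _ _ _).trans (add_le_add rounding refinement)
    _ = 2 * √(2 * (W x).toReal) * √(1 / 2) ^ k := by
        rw [mul_right_comm, Real.sqrt_mul (by positivity), sqrt_pow one_half_pos.le]
        ring

theorem IsConvexEnergy.tendsto_euler (hW : IsConvexEnergy W) (t : ℝ≥0) (x : H) :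
    Tendsto (fun k => euler W k t x) atTop (𝓝 (flow W t x)) := by
  refine tendsto_nhds_limUnder (cauchySeq_tendsto_of_complete
    (cauchySeq_apply_of_dense (fun k => hW.lipschitzWith_euler k t) hW.dense (fun y hy => ?_) x))
  refine cauchySeq_of_le_geometric (√(1 / 2)) (2 * √(2 * (W y).toReal)) ?_ fun k => ?_
  · rw [Real.sqrt_lt' one_pos]
    norm_num
  · rw [dist_comm, dist_eq_norm]
    exact hW.norm_euler_succ_sub_le k t hy

theorem IsConvexEnergy.lipschitzWith_flow (hW : IsConvexEnergy W) (t : ℝ≥0) :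
    LipschitzWith 1 (flow W t) :=
  .mk_one fun x y => le_of_tendsto ((hW.tendsto_euler t x).dist (hW.tendsto_euler t y))
    (Eventually.of_forall fun k => by simpa using (hW.lipschitzWith_euler k t).dist_le_mul x y)

theorem IsConvexEnergy.flow_zero (hW : IsConvexEnergy W) (x : H) : flow W 0 x = x :=
  tendsto_nhds_unique (hW.tendsto_euler 0 x) (by simp [euler])

theorem IsConvexEnergy.tendsto_norm_euler_add_sub (hW : IsConvexEnergy W) (s t : ℝ≥0)
    (hx : W x ≠ ⊤) :
    Tendsto (fun k => ‖euler W k (s + t) x - euler W k s (euler W k t x)‖) atTop (𝓝 0) := by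
  have hlim : Tendsto (fun k : ℕ => √(2 * (1 / 2) ^ k * (W x).toReal)) atTop (𝓝 0) := by
    simpa using (((tendsto_pow_atTop_nhds_zero_of_lt_one one_half_pos.le
      (one_half_lt_one (α := ℝ))).const_mul 2).mul_const (W x).toReal).sqrt
  refine squeeze_zero (fun _ => norm_nonneg _) (fun k => Real.le_sqrt_of_sq_le ?_) hlim
  obtain ⟨e, he, hfloor⟩ := exists_floor_add_eq (a := s * 2 ^ k) (b := t * 2 ^ k)
    (by positivity) (by positivity)
  have he' : (e : ℝ) ≤ 1 := by exact_mod_cast he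
  rw [euler, euler, euler, ← Function.iterate_add_apply, NNReal.coe_add, add_mul, hfloor]
  refine (hW.norm_iterate_resolvent_add_sub_sq_le (by positivity) e _ hx).trans ?_
  gcongr
  exact mul_le_of_le_one_left (by positivity) he'

theorem IsConvexEnergy.flow_add (hW : IsConvexEnergy W) (s t : ℝ≥0) (x : H) :
    flow W (s + t) x = flow W s (flow W t x) := by
  refine congrFun (Continuous.ext_on hW.dense (hW.lipschitzWith_flow (s + t)).continuous
    ((hW.lipschitzWith_flow s).continuous.comp (hW.lipschitzWith_flow t).continuous)
    fun y hy => tendsto_nhds_unique (hW.tendsto_euler (s + t) y) ?_) x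
  have inner_limit : Tendsto (fun k => dist (euler W k s (euler W k t y))
      (euler W k s (flow W t y))) atTop (𝓝 0) :=
    squeeze_zero (fun _ => dist_nonneg)
      (fun k => by simpa using (hW.lipschitzWith_euler k s).dist_le_mul _ _)
      (tendsto_iff_dist_tendsto_zero.1 (hW.tendsto_euler t y))
  have hlim := ((tendsto_zero_iff_norm_tendsto_zero.2 (hW.tendsto_norm_euler_add_sub s t hy)).add
    (tendsto_zero_iff_norm_tendsto_zero.2 (by simpa only [dist_eq_norm] using inner_limit))).add
    (hW.tendsto_euler s (flow W t y))
  simpa using hlim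

theorem IsConvexEnergy.toReal_euler_le (hW : IsConvexEnergy W) (hst : s ≤ t) {k : ℕ}
    (hk : dyadicFloor k s < dyadicFloor k t) (x : H) (hv : W v ≠ ⊤) :
    W (euler W k t x) ≠ ⊤ ∧ (W (euler W k t x)).toReal ≤ (W v).toReal +
      (‖euler W k s x - v‖ ^ 2 - ‖euler W k t x - v‖ ^ 2) /
        (2 * (dyadicFloor k t - dyadicFloor k s)) := by
  have hτ : (0 : ℝ) < (1 / 2) ^ k := by positivity
  obtain ⟨n, hiter, hn⟩ := exists_euler_eq_iterate W hst k x
  have hevi := hW.norm_iterate_resolvent_sub_sq_le hτ n (euler W k s x) hv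
  rw [← hiter, hn] at hevi
  obtain ⟨n, rfl⟩ : ∃ l, n = l + 1 := Nat.exists_eq_succ_of_ne_zero <| by
    rintro rfl
    simp only [Nat.cast_zero, zero_mul] at hn
    linarith
  refine ⟨?_, ?_⟩
  · rw [hiter, Function.iterate_succ_apply']
    exact (hW.isProx_resolvent hτ _).1
  · rw [← sub_le_iff_le_add', le_div_iff₀ (mul_pos two_pos (sub_pos.2 hk))]
    linarith

theorem IsConvexEnergy.toReal_flow_le (hW : IsConvexEnergy W) (hst : s < t) (x : H)
    (hv : W v ≠ ⊤) :
    W (flow W t x) ≠ ⊤ ∧ (W (flow W t x)).toReal ≤ (W v).toReal +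
      (‖flow W s x - v‖ ^ 2 - ‖flow W t x - v‖ ^ 2) / (2 * ((t : ℝ) - s)) := by
  have hpos : 0 < 2 * ((t : ℝ) - s) := mul_pos two_pos (sub_pos.2 (NNReal.coe_lt_coe.2 hst))
  have hlim : ∀ r, Tendsto (fun k => ‖euler W k r x - v‖ ^ 2) atTop (𝓝 (‖flow W r x - v‖ ^ 2)) :=
    fun r => ((hW.tendsto_euler r x).sub_const v).norm.pow 2
  have hbound := (((hlim s).sub (hlim t)).div
    (((tendsto_dyadicFloor t).sub (tendsto_dyadicFloor s)).const_mul 2) hpos.ne').const_add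
    (W v).toReal
  refine hW.isClosed_epigraph.mem_of_tendsto ((hW.tendsto_euler t x).prodMk_nhds hbound) ?_
  filter_upwards [(tendsto_dyadicFloor s).eventually_lt (tendsto_dyadicFloor t)
    (NNReal.coe_lt_coe.2 hst)] with k hk
  exact hW.toReal_euler_le hst.le hk x hv

theorem IsConvexEnergy.flow_ne_top (hW : IsConvexEnergy W) (ht : 0 < t) (x : H) :
    W (flow W t x) ≠ ⊤ := by
  obtain ⟨v, hv⟩ := hW.dense.nonempty
  exact (hW.toReal_flow_le ht x hv).1

theorem IsConvexEnergy.norm_flow_sub_sq_le (hW : IsConvexEnergy W) (hst : s ≤ t) (x : H)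
    (hv : W v ≠ ⊤) :
    ‖flow W t x - v‖ ^ 2 ≤ ‖flow W s x - v‖ ^ 2 +
      2 * ((t : ℝ) - s) * ((W v).toReal - (W (flow W t x)).toReal) := by
  rcases hst.eq_or_lt with rfl | hst
  · simp
  have hpos : 0 < 2 * ((t : ℝ) - s) := mul_pos two_pos (sub_pos.2 (NNReal.coe_lt_coe.2 hst))
  have henergy := (hW.toReal_flow_le hst x hv).2
  rw [← sub_le_iff_le_add', le_div_iff₀ hpos] at henergy
  linarith

theorem IsConvexEnergy.toReal_flow_le_toReal_flow (hW : IsConvexEnergy W) (hst : s ≤ t) (x : H)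
    (hs : W (flow W s x) ≠ ⊤) : (W (flow W t x)).toReal ≤ (W (flow W s x)).toReal := by
  rcases hst.eq_or_lt with rfl | hst
  · exact le_rfl
  have hpos : 0 < 2 * ((t : ℝ) - s) := mul_pos two_pos (sub_pos.2 (NNReal.coe_lt_coe.2 hst))
  have hevi := hW.norm_flow_sub_sq_le hst.le x hs
  rw [sub_self, norm_zero, zero_pow two_ne_zero, zero_add] at hevi
  exact sub_nonneg.1 (nonneg_of_mul_nonneg_right ((sq_nonneg _).trans hevi) hpos)

theorem IsConvexEnergy.dist_flow_le (hW : IsConvexEnergy W) (s t : ℝ≥0) (hx : W x ≠ ⊤) :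
    dist (flow W s x) (flow W t x) ≤ √(2 * dist s t * (W x).toReal) := by
  wlog hst : s ≤ t generalizing s t
  · rw [dist_comm, dist_comm s]
    exact this t s (le_of_not_ge hst)
  have hs : W (flow W s x) ≠ ⊤ := by
    rcases eq_zero_or_pos s with rfl | hs
    · rwa [hW.flow_zero]
    · exact hW.flow_ne_top hs x
  have hdecr := hW.toReal_flow_le_toReal_flow (zero_le (a := s)) x (by rwa [hW.flow_zero])
  have hevi := hW.norm_flow_sub_sq_le hst x hs
  rw [hW.flow_zero] at hdecr
  rw [sub_self, norm_zero, zero_pow two_ne_zero, zero_add] at hevi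
  have hle : (0 : ℝ) ≤ t - s := sub_nonneg.2 (NNReal.coe_le_coe.2 hst)
  rw [dist_comm, dist_comm s, dist_eq_norm, NNReal.dist_eq, abs_of_nonneg hle]
  refine Real.le_sqrt_of_sq_le (hevi.trans ?_)
  gcongr
  exact (sub_le_self _ ENNReal.toReal_nonneg).trans hdecr

theorem IsConvexEnergy.continuous_flow (hW : IsConvexEnergy W) (x : H) :
    Continuous fun t => flow W t x := by
  have continuous_of_ne_top : ∀ y, W y ≠ ⊤ → Continuous fun t => flow W t y := fun y hy =>
    continuous_iff_continuousAt.2 fun s => tendsto_iff_dist_tendsto_zero.2 <|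
      squeeze_zero (fun _ => dist_nonneg) (fun t => hW.dist_flow_le t s hy) <| by
        have hcont : Continuous fun t : ℝ≥0 => √(2 * dist t s * (W y).toReal) := by fun_prop
        simpa using hcont.tendsto s
  refine continuous_of_uniform_approx_of_continuous fun U hU => ?_
  obtain ⟨ε, hε, hεU⟩ := Metric.mem_uniformity_dist.1 hU
  obtain ⟨y, hyx, hy⟩ := Metric.dense_iff.1 hW.dense x ε hε
  refine ⟨fun t => flow W t y, continuous_of_ne_top y hy, fun t => hεU ?_⟩
  rw [Metric.mem_ball, dist_comm] at hyx
  exact ((hW.lipschitzWith_flow t).dist_le_mul x y).trans_lt (by simpa using hyx)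

/-- The gradient flow as a semigroup of contractions. -/
def IsConvexEnergy.semigroup (hW : IsConvexEnergy W) : ContractionSemigroup H where
  toFun := flow W
  map_zero' := hW.flow_zero
  map_add' := hW.flow_add
  continuous' := hW.continuous_flow
  contraction' t u v := by
    simpa [dist_eq_norm] using (hW.lipschitzWith_flow t).dist_le_mul u v

end Flow

section WeakDerivative

theorem absolutelyContinuousOnInterval_of_dist_le {X Y : Type*} [PseudoMetricSpace X]
    [PseudoMetricSpace Y] {f : ℝ → X} {g : ℝ → Y} {a b : ℝ}
    (hg : AbsolutelyContinuousOnInterval g a b)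
    (hfg : ∀ x ∈ Set.uIcc a b, ∀ y ∈ Set.uIcc a b, dist (f x) (f y) ≤ dist (g x) (g y)) :
    AbsolutelyContinuousOnInterval f a b := by
  rw [absolutelyContinuousOnInterval_iff] at hg ⊢
  intro ε hε
  obtain ⟨δ, hδ, hgδ⟩ := hg ε hε
  refine ⟨δ, hδ, fun I hI hlen => (Finset.sum_le_sum fun i hi => ?_).trans_lt (hgδ I hI hlen)⟩
  exact hfg _ (hI.1 i hi).1 _ (hI.1 i hi).2

theorem memLp_Icc_of_continuous {H : Type*} [NormedAddCommGroup H] {f : ℝ → H}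
    (hf : Continuous f) (a b : ℝ) :
    MemLp f 2 (volume.restrict (Set.Icc a b)) :=
  have ⟨C, hC⟩ := isCompact_Icc.exists_bound_of_continuousOn hf.continuousOn
  MemLp.of_bound hf.aestronglyMeasurable C
    ((ae_restrict_iff' measurableSet_Icc).2 (Eventually.of_forall hC))

variable {H : Type*} [NormedAddCommGroup H] [InnerProductSpace ℝ H]

/-- `g` is the weak derivative of `u` on `[a, b]`, that is, `u` is an indefinite integral of `g`
there. -/
structure HasWeakDerivOn (u g : ℝ → H) (a b : ℝ) : Prop where
  intervalIntegrable : IntervalIntegrable g volume a b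
  sub_eq : ∀ c d, a ≤ c → c ≤ d → d ≤ b → u d - u c = ∫ r in c..d, g r

namespace HasWeakDerivOn

variable {u g u' g' : ℝ → H} {a b : ℝ}

theorem intervalIntegrable_of_le (h : HasWeakDerivOn u g a b) {c d : ℝ} (hac : a ≤ c)
    (hcd : c ≤ d) (hdb : d ≤ b) : IntervalIntegrable g volume c d := by
  refine h.intervalIntegrable.mono_set ?_
  rw [Set.uIcc_of_le hcd, Set.uIcc_of_le (hac.trans (hcd.trans hdb))]
  exact Set.Icc_subset_Icc hac hdb

theorem sub (h : HasWeakDerivOn u g a b) (h' : HasWeakDerivOn u' g' a b) :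
    HasWeakDerivOn (u - u') (g - g') a b where
  intervalIntegrable := h.intervalIntegrable.sub h'.intervalIntegrable
  sub_eq c d hac hcd hdb := by
    simp only [Pi.sub_apply]
    rw [intervalIntegral.integral_sub (h.intervalIntegrable_of_le hac hcd hdb)
      (h'.intervalIntegrable_of_le hac hcd hdb), ← h.sub_eq c d hac hcd hdb,
      ← h'.sub_eq c d hac hcd hdb]
    abel

theorem ae_hasDerivAt [CompleteSpace H] (h : HasWeakDerivOn u g a b) :
    ∀ᵐ t, t ∈ Set.Ioo a b → HasDerivAt u (g t) t := by
  filter_upwards [h.intervalIntegrable.ae_hasDerivAt_integral] with t ht htab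
  have hderiv := ht (Set.Icc_subset_uIcc (Set.Ioo_subset_Icc_self htab)) a Set.left_mem_uIcc
  refine (hderiv.const_add (u a)).congr_of_eventuallyEq ?_
  filter_upwards [Ioo_mem_nhds htab.1 htab.2] with s hs
  rw [← h.sub_eq a s le_rfl hs.1.le hs.2.le, add_sub_cancel]

theorem absolutelyContinuousOnInterval (h : HasWeakDerivOn u g a b) (hab : a ≤ b) :
    AbsolutelyContinuousOnInterval u a b := by
  refine absolutelyContinuousOnInterval_of_dist_le
    (h.intervalIntegrable.norm.absolutelyContinuousOnInterval_intervalIntegral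
      Set.left_mem_uIcc) fun c hc d hd => ?_
  rw [Set.uIcc_of_le hab] at hc hd
  wlog hcd : c ≤ d generalizing c d
  · rw [dist_comm, dist_comm (∫ _ in a..c, _)]
    exact this d hd c hc (le_of_not_ge hcd)
  rw [dist_comm, dist_comm (∫ _ in a..c, _), dist_eq_norm, dist_eq_norm,
    h.sub_eq c d hc.1 hcd hd.2, intervalIntegral.integral_interval_sub_left
    (h.intervalIntegrable_of_le le_rfl hd.1 hd.2).norm
    (h.intervalIntegrable_of_le le_rfl hc.1 hc.2).norm]
  exact (intervalIntegral.norm_integral_le_integral_norm hcd).trans (Real.le_norm_self _)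

theorem norm_le_of_inner_nonpos [CompleteSpace H] (h : HasWeakDerivOn u g a b) (hab : a ≤ b)
    (hneg : ∀ᵐ t, t ∈ Set.Ioo a b → inner ℝ (u t) (g t) ≤ 0) : ‖u b‖ ≤ ‖u a‖ := by
  have hnorm : AbsolutelyContinuousOnInterval (fun t => ‖u t‖) a b :=
    absolutelyContinuousOnInterval_of_dist_le (h.absolutelyContinuousOnInterval hab)
      fun s _ t _ => (dist_norm_norm_le (u s) (u t)).trans_eq (dist_eq_norm _ _).symm
  have hsq : ∫ t in a..b, deriv (fun t => ‖u t‖ * ‖u t‖) t = ‖u b‖ * ‖u b‖ - ‖u a‖ * ‖u a‖ :=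
    (hnorm.fun_mul hnorm).integral_deriv_eq_sub
  have hderiv : ∀ᵐ t, t ∈ Set.Ioo a b → deriv (fun t => ‖u t‖ * ‖u t‖) t ≤ 0 := by
    filter_upwards [h.ae_hasDerivAt, hneg] with t ht htneg htab
    simp only [← pow_two, (ht htab).norm_sq.deriv]
    linarith [htneg htab]
  have hle : ∫ t in a..b, deriv (fun t => ‖u t‖ * ‖u t‖) t ≤ 0 := by
    rw [intervalIntegral.integral_of_le hab, integral_Ioc_eq_integral_Ioo]
    exact integral_nonpos_of_ae ((ae_restrict_iff' measurableSet_Ioo).2 hderiv)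
  rw [hsq, sub_nonpos] at hle
  exact (mul_self_le_mul_self_iff (norm_nonneg _) (norm_nonneg _)).2 hle

theorem ae_eq_deriv [CompleteSpace H] (h : HasWeakDerivOn u g a b) :
    g =ᵐ[volume.restrict (Set.Icc a b)] deriv u := by
  rw [← restrict_Ioo_eq_restrict_Icc]
  refine (ae_restrict_iff' measurableSet_Ioo).2 ?_
  filter_upwards [h.ae_hasDerivAt] with t ht htab using (ht htab).deriv.symm

theorem congr_ae (h : HasWeakDerivOn u g a b) (hab : a ≤ b)
    (hg : g =ᵐ[volume.restrict (Set.Icc a b)] g') : HasWeakDerivOn u g' a b where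
  intervalIntegrable := by
    rw [intervalIntegrable_iff_integrableOn_Icc_of_le hab]
    exact ((intervalIntegrable_iff_integrableOn_Icc_of_le hab).1 h.intervalIntegrable).congr hg
  sub_eq c d hac hcd hdb := by
    rw [h.sub_eq c d hac hcd hdb]
    refine intervalIntegral.integral_congr_ae_restrict
      (ae_restrict_of_ae_restrict_of_subset ?_ hg)
    rw [Set.uIoc_of_le hcd]
    exact Set.Ioc_subset_Icc_self.trans (Set.Icc_subset_Icc hac hdb)

end HasWeakDerivOn

theorem exists_weak_limit [CompleteSpace H] {ι : Type*} (𝒰 : Ultrafilter ι) {f : ι → H} {C : ℝ}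
    (hf : ∀ᶠ i in 𝒰, ‖f i‖ ≤ C) :
    ∃ g : H, ∀ φ : H, Tendsto (fun i => inner ℝ φ (f i)) 𝒰 (𝓝 (inner ℝ φ g)) := by
  set F : ι → WeakDual ℝ H := fun i => StrongDual.toWeakDual (InnerProductSpace.toDual ℝ H (f i))
  obtain ⟨ℓ, -, hℓ⟩ := (WeakDual.isCompact_closedBall (0 : StrongDual ℝ H) C).ultrafilter_le_nhds
    (𝒰.map F) <| le_principal_iff.2 <| Filter.mem_map.2 <| hf.mono fun i hi => by
      simp only [F, Set.mem_preimage, Metric.mem_closedBall, dist_zero_right]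
      exact (LinearIsometryEquiv.norm_map (InnerProductSpace.toDual ℝ H) (f i)).trans_le hi
  refine ⟨(InnerProductSpace.toDual ℝ H).symm (WeakDual.toStrongDual ℓ), fun φ => ?_⟩
  rw [real_inner_comm, InnerProductSpace.toDual_symm_apply]
  exact (((WeakDual.eval_continuous (𝕜 := ℝ) φ).tendsto ℓ).comp hℓ).congr fun i =>
    real_inner_comm _ _

theorem tendsto_inv_smul_integral [CompleteSpace H] {u : ℝ → H} (hu : Continuous u) (c : ℝ) :
    Tendsto (fun h => h⁻¹ • ∫ r in c..(c + h), u r) (𝓝[>] 0) (𝓝 (u c)) := by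
  have hderiv : HasDerivAt (fun x => ∫ r in c..x, u r) (u c) c :=
    intervalIntegral.integral_hasDerivAt_right (hu.intervalIntegrable _ _)
      (hu.stronglyMeasurableAtFilter _ _) hu.continuousAt
  simpa using hderiv.tendsto_slope_zero_right

/-- The forward difference quotient of `u` with increment `h`. -/
def differenceQuotient (u : ℝ → H) (h r : ℝ) : H :=
  h⁻¹ • (u (r + h) - u r)

theorem integral_differenceQuotient {u : ℝ → H} (hu : Continuous u) (c d h : ℝ) :
    ∫ r in c..d, differenceQuotient u h r =
      h⁻¹ • (∫ r in d..(d + h), u r) - h⁻¹ • ∫ r in c..(c + h), u r := by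
  have hint : ∀ x y, IntervalIntegrable u volume x y := fun x y => hu.intervalIntegrable x y
  have hshift : Continuous fun r => u (r + h) := by fun_prop
  simp only [differenceQuotient]
  rw [intervalIntegral.integral_smul, ← smul_sub, intervalIntegral.integral_sub
    (hshift.intervalIntegrable _ _) (hint _ _), intervalIntegral.integral_comp_add_right,
    intervalIntegral.integral_interval_sub_interval_comm' (hint _ _) (hint _ _) (hint _ _)]

theorem tendsto_integral_differenceQuotient [CompleteSpace H] {u : ℝ → H} (hu : Continuous u)
    (c d : ℝ) :
    Tendsto (fun h => ∫ r in c..d, differenceQuotient u h r) (𝓝[>] 0) (𝓝 (u d - u c)) := by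
  simp only [integral_differenceQuotient hu]
  exact (tendsto_inv_smul_integral hu d).sub (tendsto_inv_smul_integral hu c)

theorem norm_toLp_Icc_sq {f : ℝ → H} {a b : ℝ} (hab : a ≤ b)
    (hf : MemLp f 2 (volume.restrict (Set.Icc a b))) :
    ‖hf.toLp f‖ ^ 2 = ∫ r in a..b, ‖f r‖ ^ 2 := by
  rw [← real_inner_self_eq_norm_sq, L2.inner_def, intervalIntegral.integral_of_le hab,
    ← integral_Icc_eq_integral_Ioc]
  refine integral_congr_ae ?_
  filter_upwards [hf.coeFn_toLp] with r hr
  rw [hr, real_inner_self_eq_norm_sq]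

theorem integral_norm_differenceQuotient_sq (u : ℝ → H) (a b h : ℝ) :
    ∫ r in a..b, ‖differenceQuotient u h r‖ ^ 2 =
      (h ^ 2)⁻¹ * ∫ r in a..b, ‖u (r + h) - u r‖ ^ 2 := by
  simp only [differenceQuotient, norm_smul, mul_pow, norm_inv, inv_pow, Real.norm_eq_abs, sq_abs,
    intervalIntegral.integral_const_mul]

theorem tendsto_integral_of_weak_limit [CompleteSpace H] {ι : Type*} {l : Filter ι} {a b c d : ℝ}
    {f : ι → Lp H 2 (volume.restrict (Set.Icc a b))} {g : Lp H 2 (volume.restrict (Set.Icc a b))}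
    (hfg : ∀ φ, Tendsto (fun i => inner ℝ φ (f i)) l (𝓝 (inner ℝ φ g))) (hac : a ≤ c)
    (hcd : c ≤ d) (hdb : d ≤ b) (e : H) :
    Tendsto (fun i => inner ℝ e (∫ r in c..d, f i r)) l (𝓝 (inner ℝ e (∫ r in c..d, g r))) := by
  have hrestrict : (volume.restrict (Set.Icc a b)).restrict (Set.Ioc c d) =
      volume.restrict (Set.Ioc c d) :=
    Measure.restrict_restrict_of_subset (Set.Ioc_subset_Icc_self.trans (Set.Icc_subset_Icc hac hdb))
  have htest := hfg (indicatorConstLp 2 (measurableSet_Ioc (a := c) (b := d)) (by finiteness) e)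
  simpa only [L2.inner_indicatorConstLp_eq_inner_setIntegral, hrestrict,
    ← intervalIntegral.integral_of_le hcd] using htest

theorem exists_hasWeakDerivOn [CompleteSpace H] {u : ℝ → H} (hu : Continuous u) {a b C : ℝ}
    (hab : a ≤ b) (hC : ∀ h, 0 < h → ∫ r in a..b, ‖u (r + h) - u r‖ ^ 2 ≤ C * h ^ 2) :
    ∃ g : Lp H 2 (volume.restrict (Set.Icc a b)), HasWeakDerivOn u g a b := by
  have hquot : ∀ h, MemLp (differenceQuotient u h) 2 (volume.restrict (Set.Icc a b)) :=
    fun h => memLp_Icc_of_continuous (by unfold differenceQuotient; fun_prop) a b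
  have hbound : ∀ h, 0 < h → ‖(hquot h).toLp _‖ ≤ √C := fun h hh => Real.le_sqrt_of_sq_le <| by
    rw [norm_toLp_Icc_sq hab, integral_norm_differenceQuotient_sq, inv_mul_le_iff₀ (by positivity),
      mul_comm]
    exact hC h hh
  set 𝒰 := Ultrafilter.of (𝓝[>] (0 : ℝ))
  obtain ⟨g, hg⟩ := exists_weak_limit 𝒰
    (Ultrafilter.of_le _ (eventually_mem_nhdsWithin.mono fun h hh => hbound h hh))
  have hgint : IntervalIntegrable g volume a b := by
    rw [intervalIntegrable_iff_integrableOn_Icc_of_le hab]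
    exact (Lp.memLp g).integrable (by norm_num)
  refine ⟨g, hgint, fun c d hac hcd hdb => ext_inner_left ℝ fun e => ?_⟩
  refine tendsto_nhds_unique ?_ (tendsto_integral_of_weak_limit hg hac hcd hdb e)
  have hquot_eq : ∀ h, ∫ r in c..d, (hquot h).toLp _ r = ∫ r in c..d, differenceQuotient u h r :=
    fun h => intervalIntegral.integral_congr_ae_restrict <|
      ae_restrict_of_ae_restrict_of_subset (by
        rw [Set.uIoc_of_le hcd]
        exact Set.Ioc_subset_Icc_self.trans (Set.Icc_subset_Icc hac hdb)) (hquot h).coeFn_toLp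
  simp only [hquot_eq]
  exact (tendsto_const_nhds.inner (tendsto_integral_differenceQuotient hu c d)).mono_left
    (Ultrafilter.of_le _)

theorem memLp_deriv_and_hasWeakDerivOn [CompleteSpace H] {u : ℝ → H} (hu : Continuous u)
    {a b C : ℝ} (hab : a ≤ b)
    (hC : ∀ h, 0 < h → ∫ r in a..b, ‖u (r + h) - u r‖ ^ 2 ≤ C * h ^ 2) :
    MemLp (deriv u) 2 (volume.restrict (Set.Icc a b)) ∧ HasWeakDerivOn u (deriv u) a b :=
  have ⟨g, hg⟩ := exists_hasWeakDerivOn hu hab hC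
  ⟨(Lp.memLp g).ae_eq hg.ae_eq_deriv, hg.congr_ae hab hg.ae_eq_deriv⟩

theorem integral_sub_shift_le {φ : ℝ → ℝ} {a b h : ℝ} (hφ : AntitoneOn φ (Set.Ici a))
    (hnonneg : ∀ r, 0 ≤ φ r) (hab : a ≤ b) (hh : 0 < h) :
    ∫ r in a..b, (φ r - φ (r + h)) ≤ φ a * h := by
  have hint : ∀ x y, a ≤ x → a ≤ y → IntervalIntegrable φ volume x y := fun x y hx hy =>
    (hφ.mono fun z hz => (le_min hx hy).trans hz.1).intervalIntegrable
  have hshift : IntervalIntegrable (fun r => φ (r + h)) volume a b := by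
    simpa using (hint (a + h) (b + h) (by linarith) (by linarith)).comp_add_right h
  have htail : 0 ≤ ∫ r in b..(b + h), φ r :=
    intervalIntegral.integral_nonneg (by linarith) fun r _ => hnonneg r
  have hhead : ∫ r in a..(a + h), φ r ≤ ∫ _ in a..(a + h), φ a :=
    intervalIntegral.integral_mono_on (by linarith) (hint _ _ le_rfl (by linarith))
      intervalIntegrable_const fun r hr => hφ Set.self_mem_Ici hr.1 hr.1
  rw [intervalIntegral.integral_const, smul_eq_mul, add_sub_cancel_left] at hhead
  rw [intervalIntegral.integral_sub (hint a b le_rfl hab) hshift,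
    intervalIntegral.integral_comp_add_right, intervalIntegral.integral_interval_sub_interval_comm
    (hint _ _ le_rfl hab) (hint _ _ (by linarith) (by linarith)) (hint _ _ le_rfl (by linarith))]
  linarith

end WeakDerivative

section Subgradient

variable {H : Type*} [NormedAddCommGroup H] [InnerProductSpace ℝ H] {W : H → ℝ≥0∞}

theorem mem_subgradient_iff {u f : H} :
    f ∈ subgradient W u ↔
      W u ≠ ⊤ ∧ ∀ v, W v ≠ ⊤ → (W u).toReal + inner ℝ f (v - u) ≤ (W v).toReal := by
  refine ⟨fun ⟨hu, h⟩ => ⟨hu.ne, fun v hv => ?_⟩, fun ⟨hu, h⟩ => ⟨hu.lt_top, fun v => ?_⟩⟩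
  · have hle := h (v - u)
    rwa [add_sub_cancel, ← EReal.coe_ennreal_toReal hu.ne, ← EReal.coe_ennreal_toReal hv,
      ← EReal.coe_add, EReal.coe_le_coe_iff] at hle
  · by_cases hv : W (u + v) = ⊤
    · simp [hv]
    · have hle := h (u + v) hv
      rw [add_sub_cancel_left] at hle
      rw [← EReal.coe_ennreal_toReal hu, ← EReal.coe_ennreal_toReal hv]
      exact_mod_cast hle

theorem inner_sub_nonneg_of_mem_subgradient {u v f g : H} (hf : f ∈ subgradient W u)
    (hg : g ∈ subgradient W v) : 0 ≤ inner ℝ (f - g) (u - v) := by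
  rw [mem_subgradient_iff] at hf hg
  have hfv := hf.2 v hg.1
  have hgu := hg.2 u hf.1
  rw [← neg_sub u v, inner_neg_right] at hfv
  rw [inner_sub_left]
  linarith

end Subgradient

section Orbit

variable {H : Type*} [NormedAddCommGroup H] {W : H → ℝ≥0∞}

/-- The trajectory of the gradient flow started at `x`, as a function of real time, frozen at `x`
for negative times. -/
def orbit (W : H → ℝ≥0∞) (x : H) (r : ℝ) : H :=
  flow W r.toNNReal x

variable [InnerProductSpace ℝ H] [CompleteSpace H] {s t : ℝ}

theorem IsConvexEnergy.continuous_orbit (hW : IsConvexEnergy W) (x : H) : Continuous (orbit W x) :=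
  (hW.continuous_flow x).comp continuous_real_toNNReal

theorem IsConvexEnergy.orbit_ne_top (hW : IsConvexEnergy W) (ht : 0 < t) (x : H) :
    W (orbit W x t) ≠ ⊤ :=
  hW.flow_ne_top (Real.toNNReal_pos.2 ht) x

theorem IsConvexEnergy.norm_orbit_sub_sq_le (hW : IsConvexEnergy W) (hs : 0 ≤ s) (hst : s ≤ t)
    (x : H) {v : H} (hv : W v ≠ ⊤) :
    ‖orbit W x t - v‖ ^ 2 ≤ ‖orbit W x s - v‖ ^ 2 +
      2 * (t - s) * ((W v).toReal - (W (orbit W x t)).toReal) := by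
  lift s to ℝ≥0 using hs
  lift t to ℝ≥0 using s.2.trans hst
  simpa only [orbit, Real.toNNReal_coe] using
    hW.norm_flow_sub_sq_le (NNReal.coe_le_coe.1 hst) x hv

theorem IsConvexEnergy.antitoneOn_toReal_orbit (hW : IsConvexEnergy W) (x : H) :
    AntitoneOn (fun r => (W (orbit W x r)).toReal) (Set.Ioi 0) := fun _ hr _ _ hrs =>
  hW.toReal_flow_le_toReal_flow (Real.toNNReal_le_toNNReal hrs) x (hW.orbit_ne_top hr x)

theorem IsConvexEnergy.integral_norm_orbit_sub_sq_le (hW : IsConvexEnergy W) (x : H) {a b h : ℝ}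
    (ha : 0 < a) (hab : a ≤ b) (hh : 0 < h) :
    ∫ r in a..b, ‖orbit W x (r + h) - orbit W x r‖ ^ 2 ≤
      2 * (W (orbit W x a)).toReal * h ^ 2 := by
  have horbit := hW.continuous_orbit x
  set φ : ℝ → ℝ := fun r => (W (orbit W x r)).toReal
  have hanti : AntitoneOn φ (Set.Ici a) :=
    (hW.antitoneOn_toReal_orbit x).mono (Set.Ici_subset_Ioi.2 ha)
  have hint : ∀ c, a ≤ c → IntervalIntegrable (fun r => φ (r + c - a)) volume a b := fun c hc =>
    AntitoneOn.intervalIntegrable fun r hr s hs hrs => by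
      rw [Set.uIcc_of_le hab] at hr hs
      exact hanti (by simp; linarith [hr.1]) (by simp; linarith [hs.1]) (by linarith)
  have hdiff : IntervalIntegrable (fun r => φ r - φ (r + h)) volume a b := by
    refine IntervalIntegrable.sub ?_ ?_
    · simpa using hint a le_rfl
    · simpa [add_sub_assoc] using hint (a + h) (by linarith)
  calc ∫ r in a..b, ‖orbit W x (r + h) - orbit W x r‖ ^ 2
      ≤ ∫ r in a..b, 2 * h * (φ r - φ (r + h)) := by
        refine intervalIntegral.integral_mono_on hab
          (Continuous.intervalIntegrable (by fun_prop) _ _) (hdiff.const_mul _) fun r hr => ?_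
        have hr0 : 0 < r := ha.trans_le hr.1
        have hevi := hW.norm_orbit_sub_sq_le hr0.le (by linarith : r ≤ r + h) x
          (hW.orbit_ne_top hr0 x)
        rwa [sub_self, norm_zero, zero_pow two_ne_zero, zero_add, add_sub_cancel_left] at hevi
    _ = 2 * h * ∫ r in a..b, (φ r - φ (r + h)) := intervalIntegral.integral_const_mul _ _
    _ ≤ 2 * h * (φ a * h) := by
        gcongr
        exact integral_sub_shift_le hanti (fun _ => ENNReal.toReal_nonneg) hab hh
    _ = 2 * φ a * h ^ 2 := by ring

theorem IsConvexEnergy.memLp_deriv_orbit_and_hasWeakDerivOn (hW : IsConvexEnergy W) (x : H)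
    {a b : ℝ} (ha : 0 < a) (hab : a ≤ b) :
    MemLp (deriv (orbit W x)) 2 (volume.restrict (Set.Icc a b)) ∧
      HasWeakDerivOn (orbit W x) (deriv (orbit W x)) a b :=
  memLp_deriv_and_hasWeakDerivOn (hW.continuous_orbit x) hab
    fun _ hh => hW.integral_norm_orbit_sub_sq_le x ha hab hh

theorem IsConvexEnergy.ae_hasDerivAt_orbit (hW : IsConvexEnergy W) (x : H) :
    ∀ᵐ t, 0 < t → HasDerivAt (orbit W x) (deriv (orbit W x) t) t := by
  have ae_hasDerivAt : ∀ᵐ t, ∀ a b : ℚ, 0 < (a : ℝ) → t ∈ Set.Ioo (a : ℝ) b →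
      HasDerivAt (orbit W x) (deriv (orbit W x) t) t := by
    refine ae_all_iff.2 fun a => ae_all_iff.2 fun b => ?_
    by_cases hab : 0 < (a : ℝ) ∧ (a : ℝ) ≤ b
    · filter_upwards [(hW.memLp_deriv_orbit_and_hasWeakDerivOn x hab.1 hab.2).2.ae_hasDerivAt]
        with t ht _ htab using ht htab
    · exact .of_forall fun t ha htab => absurd ⟨ha, (htab.1.trans htab.2).le⟩ hab
  filter_upwards [ae_hasDerivAt] with t ht htpos
  obtain ⟨a, ha, hat⟩ := exists_rat_btwn htpos
  obtain ⟨b, htb⟩ := exists_rat_gt t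
  exact ht a b ha ⟨hat, htb⟩

theorem IsConvexEnergy.neg_mem_subgradient_orbit (hW : IsConvexEnergy W) (x : H) {g : H}
    (ht : 0 < t) (hg : HasDerivAt (orbit W x) g t) : -g ∈ subgradient W (orbit W x t) := by
  refine mem_subgradient_iff.2 ⟨hW.orbit_ne_top ht x, fun v hv => ?_⟩
  have hslope := (hg.sub_const v).norm_sq.tendsto_slope_zero_right
  have hadd : Tendsto (fun h : ℝ => t + h) (𝓝[>] 0) (𝓝 t) := by
    simpa using ((continuous_const_add t).tendsto 0).mono_left nhdsWithin_le_nhds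
  have hbound := tendsto_const_nhds (x := (W v).toReal) |>.sub (hslope.div_const 2)
  -- Dividing the evolution variational inequality by the time step and letting it tend to zero.
  have hlimit := hW.isClosed_epigraph.mem_of_tendsto
    ((hg.continuousAt.tendsto.comp hadd).prodMk_nhds hbound) <| by
      filter_upwards [self_mem_nhdsWithin] with h (hh : 0 < h)
      refine ⟨hW.orbit_ne_top (by linarith) x, ?_⟩
      have hevi := hW.norm_orbit_sub_sq_le ht.le (by linarith : t ≤ t + h) x hv
      rw [le_sub_comm, smul_eq_mul, div_le_iff₀ two_pos, inv_mul_le_iff₀ hh]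
      dsimp only [Function.comp_apply]
      linarith
  rw [inner_neg_left, ← neg_sub (orbit W x t) v, inner_neg_right, neg_neg, real_inner_comm]
  have := hlimit.2
  linarith

theorem IsConvexEnergy.generates (hW : IsConvexEnergy W) : Generates W hW.semigroup := by
  refine fun x => ⟨hW.continuous_flow x, hW.flow_zero x, deriv (orbit W x), fun a b ha hab => ?_,
    (ae_restrict_iff' measurableSet_Ioi).2 ?_⟩
  · obtain ⟨hmemLp, hderiv⟩ := hW.memLp_deriv_orbit_and_hasWeakDerivOn x (NNReal.coe_pos.2 ha)
      (NNReal.coe_le_coe.2 hab)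
    refine ⟨hmemLp, ?_⟩
    simpa only [orbit, Real.toNNReal_coe, IsConvexEnergy.semigroup] using
      hderiv.sub_eq a b le_rfl (NNReal.coe_le_coe.2 hab) le_rfl
  · filter_upwards [hW.ae_hasDerivAt_orbit x] with t ht htpos using
      hW.neg_mem_subgradient_orbit x htpos (ht htpos)

end Orbit

section Uniqueness

variable {H : Type*} [NormedAddCommGroup H] [InnerProductSpace ℝ H] {W : H → ℝ≥0∞}

theorem IsStrongSolution.exists_hasWeakDerivOn {x : H} {u : ℝ≥0 → H}
    (hu : IsStrongSolution W x u) :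
    ∃ g : ℝ → H, (∀ a b : ℝ, 0 < a → a ≤ b → HasWeakDerivOn (fun s => u s.toNNReal) g a b) ∧
      ∀ᵐ s, 0 < s → -g s ∈ subgradient W (u s.toNNReal) := by
  obtain ⟨-, -, g, hg, hgW⟩ := hu
  refine ⟨g, fun a b ha hab => ⟨?_, fun c d hac hcd _ => ?_⟩,
    (ae_restrict_iff' measurableSet_Ioi).1 hgW⟩
  · rw [intervalIntegrable_iff_integrableOn_Icc_of_le hab]
    lift a to ℝ≥0 using ha.le
    lift b to ℝ≥0 using a.2.trans hab
    exact (hg a b ha hab).1.integrable (by norm_num)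
  · lift c to ℝ≥0 using ha.le.trans hac
    lift d to ℝ≥0 using c.2.trans hcd
    simpa only [Real.toNNReal_coe] using (hg c d (ha.trans_le hac) hcd).2

variable [CompleteSpace H]

theorem IsStrongSolution.norm_sub_le {x y : H} {u v : ℝ≥0 → H} (hu : IsStrongSolution W x u)
    (hv : IsStrongSolution W y v) (t : ℝ≥0) : ‖u t - v t‖ ≤ ‖x - y‖ := by
  obtain ⟨f, hf, hfW⟩ := hu.exists_hasWeakDerivOn
  obtain ⟨g, hg, hgW⟩ := hv.exists_hasWeakDerivOn
  have norm_sub_le_of_pos : ∀ a, 0 < a → a ≤ t → ‖u t - v t‖ ≤ ‖u a - v a‖ := fun a ha hat => by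
    have hle := ((hf a t ha hat).sub (hg a t ha hat)).norm_le_of_inner_nonpos
      (NNReal.coe_le_coe.2 hat) <| by
        filter_upwards [hfW, hgW] with s hfs hgs hs
        have hspos := (NNReal.coe_pos.2 ha).trans hs.1
        have hmono := inner_sub_nonneg_of_mem_subgradient (hfs hspos) (hgs hspos)
        rw [neg_sub_neg, ← neg_sub (f s) (g s), inner_neg_left, real_inner_comm] at hmono
        simpa using hmono
    simpa using hle
  rw [← hu.2.1, ← hv.2.1]
  rcases eq_zero_or_pos t with rfl | ht
  · exact le_rfl
  refine ge_of_tendsto (((hu.1.sub hv.1).norm.tendsto 0).mono_left nhdsWithin_le_nhds)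
    (b := ‖u t - v t‖) (x := 𝓝[>] 0) ?_
  filter_upwards [Ioo_mem_nhdsGT ht] with a ha using norm_sub_le_of_pos a ha.1 ha.2.le

theorem IsStrongSolution.eq {x : H} {u v : ℝ≥0 → H} (hu : IsStrongSolution W x u)
    (hv : IsStrongSolution W x v) : u = v :=
  funext fun t => sub_eq_zero.1 <| norm_le_zero_iff.1 <| by simpa using hu.norm_sub_le hv t

theorem Generates.eq {S T : ContractionSemigroup H} (hS : Generates W S) (hT : Generates W T) :
    S = T := by
  ext t u
  exact congrFun ((hS u).eq (hT u)) t

theorem IsConvexEnergy.existsUnique_generates (hW : IsConvexEnergy W) : ∃! S, Generates W S :=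
  ⟨hW.semigroup, hW.generates, fun _ hS => hS.eq hW.generates⟩

theorem Generates.toFun_eq_flow {S : ContractionSemigroup H} (hS : Generates W S)
    (hW : IsConvexEnergy W) : S.toFun = flow W := by
  rw [hS.eq hW.generates, IsConvexEnergy.semigroup]

end Uniqueness

section Reflection

variable {H : Type*} [NormedAddCommGroup H] {W : H → ℝ≥0∞} {τ : ℝ}

theorem IsProx.comp_neg {x z : H} (h : IsProx W τ x z) :
    IsProx (fun u => W (-u)) τ (-x) (-z) := by
  refine ⟨by simpa using h.1, fun v hv => ?_⟩
  have hle := h.2 (-v) hv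
  simp only [sub_neg_eq_add, neg_neg] at hle ⊢
  rwa [← norm_neg, ← norm_neg (-x - v), ← norm_neg (-z + x), neg_sub', neg_sub', neg_add,
    neg_neg, neg_neg, sub_neg_eq_add, sub_neg_eq_add, ← sub_eq_add_neg]

variable [InnerProductSpace ℝ H]

theorem IsConvexEnergy.comp_neg (hW : IsConvexEnergy W) : IsConvexEnergy fun u => W (-u) where
  convex := ⟨convex_univ, fun x _ y _ a b ha hb hab => by
    simpa only [neg_add, smul_neg] using
      hW.convex.2 (Set.mem_univ (-x)) (Set.mem_univ (-y)) ha hb hab⟩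
  lsc := hW.lsc.comp continuous_neg
  dense := hW.dense.preimage (Homeomorph.neg H).isOpenMap

variable [CompleteSpace H]

theorem IsConvexEnergy.semiconj_neg_resolvent (hW : IsConvexEnergy W) (hτ : 0 < τ) :
    Function.Semiconj Neg.neg (resolvent W τ) (resolvent (fun u => W (-u)) τ) := fun x =>
  ((hW.isProx_resolvent hτ x).comp_neg).resolvent_eq.symm

theorem IsConvexEnergy.flow_comp_neg (hW : IsConvexEnergy W) (t : ℝ≥0) (x : H) :
    flow (fun u => W (-u)) t x = -flow W t (-x) := by
  refine tendsto_nhds_unique (hW.comp_neg.tendsto_euler t x)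
    ((hW.tendsto_euler t (-x)).neg.congr fun k => ?_)
  simpa only [euler, neg_neg] using
    (hW.semiconj_neg_resolvent (by positivity)).iterate_right _ (-x)

end Reflection

section Comparison

/-- Submodularity of an extended-valued functional on a lattice. -/
def IsSubmodular {α : Type*} [Lattice α] (f : α → ℝ≥0∞) : Prop :=
  ∀ a b, f (a ⊓ b) + f (a ⊔ b) ≤ f a + f b

/-- `f a + g b` does not increase when `a` is truncated to the order interval `[-b, b]` and `b` is
enlarged to `|a| ⊔ b`. This is what domination of semigroups amounts to for their energies. -/
def TruncationDominated {α : Type*} [Lattice α] [AddGroup α] (f g : α → ℝ≥0∞) : Prop :=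
  ∀ a b, 0 ≤ b → f ((a ⊓ b) ⊔ -b) + g (|a| ⊔ b) ≤ f a + g b

theorem IsSubmodular.comp_neg {α : Type*} [Lattice α] [AddCommGroup α] [AddLeftMono α]
    {f : α → ℝ≥0∞} (hf : IsSubmodular f) : IsSubmodular fun a => f (-a) := fun a b => by
  simpa only [← neg_sup, ← neg_inf, add_comm] using hf (-a) (-b)

theorem IsProx.eq_of_exchange {H : Type*} [NormedAddCommGroup H] {W₁ W₂ : H → ℝ≥0∞} {τ : ℝ}
    (hτ : 0 ≤ τ) {u v a b a' b' : H} (ha : IsProx W₁ τ u a) (hb : IsProx W₂ τ v b)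
    (hW : W₁ a' + W₂ b' ≤ W₁ a + W₂ b)
    (hnorm : ‖a' - u‖ ^ 2 + ‖b' - v‖ ^ 2 ≤ ‖a - u‖ ^ 2 + ‖b - v‖ ^ 2) : a' = a ∧ b' = b := by
  have hfin : W₁ a + W₂ b ≠ ⊤ := ENNReal.add_ne_top.2 ⟨ha.1, hb.1⟩
  obtain ⟨ha', hb'⟩ := ENNReal.add_ne_top.1 (ne_top_of_le_ne_top hfin hW)
  have hreal := ENNReal.toReal_mono hfin hW
  rw [ENNReal.toReal_add ha' hb', ENNReal.toReal_add ha.1 hb.1] at hreal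
  have haprox := ha.2 a' ha'
  have hbprox := hb.2 b' hb'
  rw [norm_sub_rev u a', norm_sub_rev a a'] at haprox
  rw [norm_sub_rev v b', norm_sub_rev b b'] at hbprox
  have hle : ‖a' - a‖ ^ 2 + ‖b' - b‖ ^ 2 ≤ 0 := by nlinarith
  have hzero := (add_eq_zero_iff_of_nonneg (sq_nonneg ‖a' - a‖) (sq_nonneg ‖b' - b‖)).1
    (hle.antisymm (by positivity))
  simpa only [sq_eq_zero_iff, norm_eq_zero, sub_eq_zero] using hzero

theorem isProx_zero {H : Type*} [NormedAddCommGroup H] {W : H → ℝ≥0∞} (h0 : W 0 = 0) {τ : ℝ}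
    (hτ : 0 ≤ τ) : IsProx W τ 0 0 := by
  refine ⟨by simp [h0], fun v _ => ?_⟩
  simpa [h0] using by positivity

theorem resolvent_zero {H : Type*} [NormedAddCommGroup H] [InnerProductSpace ℝ H] {W : H → ℝ≥0∞}
    (h0 : W 0 = 0) {τ : ℝ} (hτ : 0 ≤ τ) : resolvent W τ 0 = 0 :=
  (isProx_zero h0 hτ).resolvent_eq

variable {X : Type*} [MeasurableSpace X] {μ : Measure X}

theorem norm_sq_eq_integral (f : Lp ℝ 2 μ) : ‖f‖ ^ 2 = ∫ x, f x ^ 2 ∂μ := by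
  rw [← real_inner_self_eq_norm_sq, L2.inner_def]
  exact integral_congr_ae (.of_forall fun x => by simp [sq])

theorem norm_sub_sq_add_norm_sub_sq_le {a b u v a' b' : Lp ℝ 2 μ}
    (h : ∀ᵐ x ∂μ, (a' x - u x) ^ 2 + (b' x - v x) ^ 2 ≤ (a x - u x) ^ 2 + (b x - v x) ^ 2) :
    ‖a' - u‖ ^ 2 + ‖b' - v‖ ^ 2 ≤ ‖a - u‖ ^ 2 + ‖b - v‖ ^ 2 := by
  have hint : ∀ f : Lp ℝ 2 μ, Integrable (fun x => f x ^ 2) μ := fun f =>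
    (Lp.memLp f).integrable_sq
  simp only [norm_sq_eq_integral]
  rw [← integral_add (hint _) (hint _), ← integral_add (hint _) (hint _)]
  refine integral_mono_ae ((hint _).add (hint _)) ((hint _).add (hint _)) ?_
  filter_upwards [h, Lp.coeFn_sub a' u, Lp.coeFn_sub b' v, Lp.coeFn_sub a u, Lp.coeFn_sub b v]
    with x hx hau' hbv' hau hbv
  simpa only [hau', hbv', hau, hbv, Pi.sub_apply] using hx

theorem sq_inf_sub_inf_add_sq_sup_sub_sup_le (a b c d : ℝ) :
    (a ⊓ b - c ⊓ d) ^ 2 + (a ⊔ b - c ⊔ d) ^ 2 ≤ (a - c) ^ 2 + (b - d) ^ 2 := by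
  rcases le_total a b with hab | hab <;> rcases le_total c d with hcd | hcd <;>
    simp only [hab, hcd, inf_of_le_left, inf_of_le_right, sup_of_le_left, sup_of_le_right] <;>
    nlinarith [mul_nonneg (sub_nonneg.2 hab) (sub_nonneg.2 hcd)]

theorem inf_sup_neg_eq {a b : ℝ} (hb : 0 ≤ b) : (a ⊓ b) ⊔ -b = -(-(a ⊓ b) ⊓ (a ⊔ b)) := by
  rw [neg_inf, neg_neg, neg_sup]
  rcases le_total a b with hab | hab
  · rw [inf_eq_left.2 hab, inf_eq_right.2 (neg_le_neg hab)]
  · rw [inf_eq_right.2 hab, inf_eq_left.2 (neg_le_neg hab), sup_eq_left.2 (by linarith),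
      sup_eq_left.2 (by linarith)]

theorem abs_sup_eq {a b : ℝ} (hb : 0 ≤ b) : |a| ⊔ b = -(a ⊓ b) ⊔ (a ⊔ b) := by
  rcases le_total a b with hab | hab
  · rw [inf_eq_left.2 hab, sup_eq_right.2 hab, abs, sup_right_comm, sup_eq_right.2 hab, sup_comm]
  · rw [inf_eq_right.2 hab, sup_eq_left.2 hab, abs_of_nonneg (hb.trans hab), sup_eq_left.2 hab,
      sup_eq_right.2 (by linarith)]

/- Truncation is the composition of the reflections of the plane across the lines `a = b` and
`a = -b`, folded onto one side. -/
theorem sq_truncation_sub_add_sq_sub_le {a b c d : ℝ} (hb : 0 ≤ b) (hd : 0 ≤ d) :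
    ((a ⊓ b) ⊔ -b - (c ⊓ d) ⊔ -d) ^ 2 + (|a| ⊔ b - |c| ⊔ d) ^ 2 ≤
      (a - c) ^ 2 + (b - d) ^ 2 := by
  have first := sq_inf_sub_inf_add_sq_sup_sub_sup_le a b c d
  have second := sq_inf_sub_inf_add_sq_sup_sub_sup_le (-(a ⊓ b)) (a ⊔ b) (-(c ⊓ d)) (c ⊔ d)
  rw [inf_sup_neg_eq hb, inf_sup_neg_eq hd, abs_sup_eq hb, abs_sup_eq hd]
  linarith

variable {W W₁ W₂ : Lp ℝ 2 μ → ℝ≥0∞} {τ : ℝ}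

theorem IsConvexEnergy.monotone_resolvent (hW : IsConvexEnergy W) (hsub : IsSubmodular W)
    (hτ : 0 < τ) : Monotone (resolvent W τ) := fun u v huv => by
  set a := resolvent W τ u
  set b := resolvent W τ v
  refine inf_eq_left.1 ((hW.isProx_resolvent hτ u).eq_of_exchange hτ.le
    (hW.isProx_resolvent hτ v) (hsub a b) (norm_sub_sq_add_norm_sub_sq_le ?_)).1
  filter_upwards [Lp.coeFn_inf a b, Lp.coeFn_sup a b, (Lp.coeFn_le u v).2 huv] with x hinf hsup hx
  rw [hinf, hsup]
  have le := sq_inf_sub_inf_add_sq_sup_sub_sup_le (a x) (b x) (u x) (v x)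
  rwa [inf_eq_left.2 hx, sup_eq_right.2 hx] at le

theorem IsConvexEnergy.abs_resolvent_le (hW₁ : IsConvexEnergy W₁) (hW₂ : IsConvexEnergy W₂)
    (hdom : TruncationDominated W₁ W₂) (hτ : 0 < τ) {u v : Lp ℝ 2 μ} (huv : |u| ≤ v)
    (hpos : 0 ≤ resolvent W₂ τ v) : |resolvent W₁ τ u| ≤ resolvent W₂ τ v := by
  set a := resolvent W₁ τ u
  set b := resolvent W₂ τ v
  refine sup_eq_right.1 ((hW₁.isProx_resolvent hτ u).eq_of_exchange hτ.le
    (hW₂.isProx_resolvent hτ v) (hdom a b hpos) (norm_sub_sq_add_norm_sub_sq_le ?_)).2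
  filter_upwards [Lp.coeFn_inf a b, Lp.coeFn_sup (a ⊓ b) (-b), Lp.coeFn_neg b,
    Lp.coeFn_sup |a| b, Lp.coeFn_abs a, Lp.coeFn_abs u, (Lp.coeFn_le |u| v).2 huv,
    (Lp.coeFn_nonneg b).2 hpos] with x hinf htrunc hneg hsup habs habsu hux hbx
  rw [htrunc, hsup, Pi.sup_apply, Pi.sup_apply, hinf, hneg, habs]
  rw [habsu] at hux
  have le := sq_truncation_sub_add_sq_sub_le (a := a x) (c := u x) hbx ((abs_nonneg _).trans hux)
  rwa [inf_eq_left.2 (abs_le.1 hux).2, sup_eq_left.2 (abs_le.1 hux).1, sup_eq_right.2 hux] at le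

theorem IsConvexEnergy.flow_zero_right (hW : IsConvexEnergy W) (h0 : W 0 = 0) (t : ℝ≥0) :
    flow W t 0 = 0 := by
  refine tendsto_nhds_unique (hW.tendsto_euler t 0) (tendsto_const_nhds.congr fun k => ?_)
  exact (Function.iterate_fixed (resolvent_zero h0 (by positivity)) _).symm

theorem IsConvexEnergy.orderPreserving_flow (hW : IsConvexEnergy W) (hsub : IsSubmodular W) :
    OrderPreserving (flow W) := fun t u v huv =>
  le_of_tendsto_of_tendsto' (hW.tendsto_euler t u) (hW.tendsto_euler t v) fun _ =>
    (hW.monotone_resolvent hsub (by positivity)).iterate _ huv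

theorem IsConvexEnergy.isPositive_flow (hW : IsConvexEnergy W) (h0 : W 0 = 0)
    (hsub : IsSubmodular W) : IsPositive (flow W) := fun t u hu =>
  (hW.flow_zero_right h0 t).symm.trans_le (hW.orderPreserving_flow hsub t 0 u hu)

theorem IsConvexEnergy.dominatedBy_flow (hW₁ : IsConvexEnergy W₁) (hW₂ : IsConvexEnergy W₂)
    (h0 : W₂ 0 = 0) (hsub : IsSubmodular W₂) (hdom : TruncationDominated W₁ W₂) :
    DominatedBy (flow W₁) (flow W₂) := by
  refine ⟨hW₂.orderPreserving_flow hsub, fun t u v huv => ?_⟩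
  refine le_of_tendsto_of_tendsto' ((hW₁.tendsto_euler t u).sup_nhds
    (hW₁.tendsto_euler t u).neg) (hW₂.tendsto_euler t v) fun k => ?_
  change |euler W₁ k t u| ≤ euler W₂ k t v
  unfold euler
  generalize ⌊(t : ℝ) * 2 ^ k⌋₊ = n
  induction n with
  | zero => exact huv
  | succ n ih =>
    rw [Function.iterate_succ_apply', Function.iterate_succ_apply']
    refine hW₁.abs_resolvent_le hW₂ hdom (by positivity) ih ?_
    rw [← resolvent_zero h0 (by positivity : (0 : ℝ) ≤ (1 / 2) ^ k)]
    exact hW₂.monotone_resolvent hsub (by positivity) ((abs_nonneg _).trans ih)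

theorem IsConvexEnergy.totallyDominatedBy_flow (hW₁ : IsConvexEnergy W₁)
    (hW₂ : IsConvexEnergy W₂) (h0 : W₂ 0 = 0) (hsub : IsSubmodular W₂)
    (hdom : TruncationDominated W₁ W₂) (hdom_neg : TruncationDominated W₁ fun u => W₂ (-u)) :
    TotallyDominatedBy (flow W₁) (flow W₂) := by
  refine ⟨hW₁.dominatedBy_flow hW₂ h0 hsub hdom, ?_⟩
  have hneg : flow (fun u => W₂ (-u)) = fun t u => -flow W₂ t (-u) := funext₂ hW₂.flow_comp_neg
  exact hneg ▸ hW₁.dominatedBy_flow hW₂.comp_neg (by simpa using h0) hsub.comp_neg hdom_neg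

end Comparison

section SelfSimilar

variable {E : Type*} [NormedAddCommGroup E] [NormedSpace ℝ E] {N : ℕ} {p : Fin N → E}

theorem continuous_similarity (i : Fin N) : Continuous (similarity p i) := by
  unfold similarity
  fun_prop

theorem similarity_injective (i : Fin N) : Function.Injective (similarity p i) := by
  intro x y h
  simpa [similarity] using h

theorem mem_levelSet_zero {x : E} : x ∈ levelSet p 0 ↔ ∃ i, p i = x := by
  simp [levelSet]

theorem mem_levelSet_succ {m : ℕ} {x : E} :
    x ∈ levelSet p (m + 1) ↔ ∃ i, ∃ y ∈ levelSet p m, similarity p i y = x := by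
  simp [levelSet]

theorem similarity_mem_gasket (i : Fin N) {x : E} (hx : x ∈ gasket p) :
    similarity p i x ∈ gasket p := by
  refine map_mem_closure (continuous_similarity i) hx fun y hy => ?_
  obtain ⟨m, hm⟩ := Set.mem_iUnion.1 hy
  exact Set.mem_iUnion.2 ⟨m + 1, mem_levelSet_succ.2 ⟨i, y, hm, rfl⟩⟩

theorem gasket_subset_of_isClosed {s : Set E} (hs : IsClosed s) (hp : ∀ i, p i ∈ s)
    (h : ∀ i, ∀ x ∈ s, similarity p i x ∈ s) : gasket p ⊆ s := by
  refine closure_minimal (Set.iUnion_subset fun m => ?_) hs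
  induction m with
  | zero =>
    intro x hx
    obtain ⟨i, rfl⟩ := mem_levelSet_zero.1 hx
    exact hp i
  | succ m ih =>
    intro x hx
    obtain ⟨i, y, hy, rfl⟩ := mem_levelSet_succ.1 hx
    exact h i y (ih hy)

/-- The similarity `F_i` as a self-map of the gasket. -/
def cellMap (p : Fin N → E) (i : Fin N) (x : gasket p) : gasket p :=
  ⟨similarity p i x, similarity_mem_gasket i x.2⟩

/-- The composition `F_w` of similarities as a self-map of the gasket; its range is the cell of
`w`. -/
def cellWord (p : Fin N → E) : List (Fin N) → gasket p → gasket p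
  | [] => id
  | i :: w => cellMap p i ∘ cellWord p w

theorem continuous_cellMap (i : Fin N) : Continuous (cellMap p i) :=
  ((continuous_similarity i).comp continuous_subtype_val).subtype_mk _

theorem cellMap_injective (i : Fin N) : Function.Injective (cellMap p i) := fun _ _ h =>
  Subtype.ext (similarity_injective i (congrArg Subtype.val h))

theorem dist_cellMap (i : Fin N) (x y : gasket p) :
    dist (cellMap p i x) (cellMap p i y) = 1 / 2 * dist x y := by
  rw [Subtype.dist_eq, Subtype.dist_eq]
  simp only [cellMap, similarity, dist_add_right]
  rw [dist_smul₀]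
  norm_num

theorem continuous_cellWord (w : List (Fin N)) : Continuous (cellWord p w) := by
  induction w with
  | nil => exact continuous_id
  | cons i w ih => exact (continuous_cellMap i).comp ih

theorem dist_cellWord (w : List (Fin N)) (x y : gasket p) :
    dist (cellWord p w x) (cellWord p w y) = (1 / 2) ^ w.length * dist x y := by
  induction w with
  | nil => simp [cellWord]
  | cons i w ih =>
    rw [cellWord, Function.comp_apply, Function.comp_apply, dist_cellMap, ih, List.length_cons]
    ring

theorem cellMap_vertex (i : Fin N) : cellMap p i (vertex p i) = vertex p i := by
  apply Subtype.ext
  simp only [cellMap, vertex, similarity]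
  module

theorem cellMap_vertex_comm (i j : Fin N) :
    cellMap p i (vertex p j) = cellMap p j (vertex p i) := by
  apply Subtype.ext
  simp only [cellMap, vertex, similarity]
  module

theorem coe_cellWord (w : List (Fin N)) (x : gasket p) :
    (cellWord p w x : E) = wordMap p w x := by
  induction w with
  | nil => rfl
  | cons i w ih => simp only [cellWord, wordMap, Function.comp_apply, cellMap, ih]

theorem mem_gasketLevel {m : ℕ} {x : gasket p} : x ∈ gasketLevel p m ↔ (x : E) ∈ levelSet p m := by
  classical
  simp [gasketLevel]

theorem mem_gasketLevel_zero {x : gasket p} : x ∈ gasketLevel p 0 ↔ ∃ i, vertex p i = x := by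
  rw [mem_gasketLevel, mem_levelSet_zero]
  simp only [vertex, Subtype.ext_iff]

theorem mem_gasketLevel_succ {m : ℕ} {x : gasket p} :
    x ∈ gasketLevel p (m + 1) ↔ ∃ i, ∃ y ∈ gasketLevel p m, cellMap p i y = x := by
  rw [mem_gasketLevel, mem_levelSet_succ]
  constructor
  · rintro ⟨i, y, hy, h⟩
    exact ⟨i, ⟨y, levelSet_subset_gasket p m hy⟩, mem_gasketLevel.2 hy, Subtype.ext h⟩
  · rintro ⟨i, y, hy, rfl⟩
    exact ⟨i, y, mem_gasketLevel.1 hy, rfl⟩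

theorem vertex_mem_gasketLevel (i : Fin N) (m : ℕ) : vertex p i ∈ gasketLevel p m := by
  induction m with
  | zero => exact mem_gasketLevel_zero.2 ⟨i, rfl⟩
  | succ m ih => exact mem_gasketLevel_succ.2 ⟨i, _, ih, cellMap_vertex i⟩

theorem dense_iUnion_gasketLevel : Dense (⋃ m, (gasketLevel p m : Set (gasket p))) := by
  intro x
  have hx : (x : E) ∈ closure (⋃ m, (levelSet p m : Set E)) := x.2
  rw [closure_subtype]
  convert hx using 1
  congr 1
  ext y
  simp only [Set.mem_image, Set.mem_iUnion, Finset.mem_coe, mem_gasketLevel]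
  constructor
  · rintro ⟨z, ⟨m, hm⟩, rfl⟩
    exact ⟨m, hm⟩
  · rintro ⟨m, hm⟩
    exact ⟨⟨y, levelSet_subset_gasket p m hm⟩, ⟨m, hm⟩, rfl⟩

theorem isCompact_gasket [ProperSpace E] : IsCompact (gasket p) := by
  obtain ⟨R, hR⟩ := (Set.finite_range p).isBounded.subset_closedBall 0
  refine (isCompact_closedBall (0 : E) R).of_isClosed_subset isClosed_closure
    (gasket_subset_of_isClosed Metric.isClosed_closedBall (fun i => hR ⟨i, rfl⟩)
      fun i x hx => ?_)
  have hpi := hR ⟨i, rfl⟩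
  exact convex_closedBall (0 : E) R hx hpi (by norm_num) (by norm_num) (by norm_num)

instance [ProperSpace E] : CompactSpace (gasket p) := isCompact_iff_compactSpace.1 isCompact_gasket

theorem exists_cellMap_eq [ProperSpace E] (x : gasket p) : ∃ i y, cellMap p i y = x := by
  have hcl : IsClosed (⋃ i, Set.range (cellMap p i)) :=
    isClosed_iUnion_of_finite fun i => (isCompact_range (continuous_cellMap i)).isClosed
  have hsub : (⋃ m, (gasketLevel p m : Set (gasket p))) ⊆ ⋃ i, Set.range (cellMap p i) := by
    refine Set.iUnion_subset fun m y hy => ?_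
    cases m with
    | zero =>
      obtain ⟨i, rfl⟩ := mem_gasketLevel_zero.1 hy
      exact Set.mem_iUnion.2 ⟨i, _, cellMap_vertex i⟩
    | succ m =>
      obtain ⟨i, z, -, rfl⟩ := mem_gasketLevel_succ.1 hy
      exact Set.mem_iUnion.2 ⟨i, z, rfl⟩
  simpa using closure_minimal hsub hcl (dense_iUnion_gasketLevel x)

theorem exists_cellWord_eq [ProperSpace E] (m : ℕ) (x : gasket p) :
    ∃ w y, w.length = m ∧ cellWord p w y = x := by
  induction m generalizing x with
  | zero => exact ⟨[], x, rfl, rfl⟩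
  | succ m ih =>
    obtain ⟨i, y, rfl⟩ := exists_cellMap_eq x
    obtain ⟨w, z, rfl, rfl⟩ := ih y
    exact ⟨i :: w, z, rfl, rfl⟩

theorem eventually_mem_cell [ProperSpace E] (m : ℕ) (x : gasket p) :
    ∀ᶠ y in 𝓝 x, ∃ w x' y', w.length = m ∧ cellWord p w x' = x ∧ cellWord p w y' = y := by
  have avoids_cell : ∀ᶠ y in 𝓝 x, ∀ w ∈ {w : List (Fin N) | w.length = m},
      x ∉ Set.range (cellWord p w) → y ∉ Set.range (cellWord p w) := by
    refine (eventually_all_finite (List.finite_length_eq (Fin N) m)).2 fun w _ => ?_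
    rw [eventually_imp_distrib_left]
    exact fun hx => (isCompact_range (continuous_cellWord w)).isClosed.isOpen_compl.mem_nhds hx
  filter_upwards [avoids_cell] with y hy
  obtain ⟨w, y', hw, rfl⟩ := exists_cellWord_eq m y
  obtain ⟨x', hx'⟩ := not_imp_not.1 (hy w hw) ⟨y', rfl⟩
  exact ⟨w, x', y', hw, hx', rfl⟩

theorem sameCell_iff {m : ℕ} {x y : gasket p} : SameCell p m x y ↔
    ∃ w x' y', w.length = m ∧ cellWord p w x' = x ∧ cellWord p w y' = y := by
  constructor
  · rintro ⟨w, hw, ⟨x', hx', hx⟩, ⟨y', hy', hy⟩⟩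
    exact ⟨w, ⟨x', hx'⟩, ⟨y', hy'⟩, hw, Subtype.ext (by rw [coe_cellWord]; exact hx),
      Subtype.ext (by rw [coe_cellWord]; exact hy)⟩
  · rintro ⟨w, x', y', hw, rfl, rfl⟩
    exact ⟨w, hw, ⟨x', x'.2, (coe_cellWord w x').symm⟩, ⟨y', y'.2, (coe_cellWord w y').symm⟩⟩

theorem sameCell_zero (x y : gasket p) : SameCell p 0 x y :=
  sameCell_iff.2 ⟨[], x, y, rfl, rfl, rfl⟩

theorem sameCell_succ {m : ℕ} {x y : gasket p} : SameCell p (m + 1) x y ↔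
    ∃ i x' y', cellMap p i x' = x ∧ cellMap p i y' = y ∧ SameCell p m x' y' := by
  rw [sameCell_iff]
  constructor
  · rintro ⟨w, x', y', hw, rfl, rfl⟩
    obtain ⟨i, v, rfl⟩ := List.exists_cons_of_length_eq_add_one hw
    exact ⟨i, cellWord p v x', cellWord p v y', rfl, rfl,
      sameCell_iff.2 ⟨v, x', y', by simpa using hw, rfl, rfl⟩⟩
  · rintro ⟨i, x', y', rfl, rfl, h⟩
    obtain ⟨w, x'', y'', hw, rfl, rfl⟩ := sameCell_iff.1 h
    exact ⟨i :: w, x'', y'', by simp [hw], rfl, rfl⟩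

end SelfSimilar

section Simplex

variable {E : Type*} [NormedAddCommGroup E] [InnerProductSpace ℝ E] {N : ℕ} {p : Fin N → E}

/-- The `i`-th barycentric coordinate with respect to the regular simplex `p`. -/
def bary (p : Fin N → E) (i : Fin N) (x : E) : ℝ :=
  1 - 2 / N * inner ℝ (x - p i) (∑ k, (p k - p i))

theorem continuous_bary (i : Fin N) : Continuous (bary p i) := by
  unfold bary
  fun_prop

theorem similarity_sub (i j : Fin N) (x : E) :
    similarity p j x - p i = (1 / 2 : ℝ) • (x - p i) + (1 / 2 : ℝ) • (p j - p i) := by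
  unfold similarity
  module

theorem norm_similarity_sub_le (i j : Fin N) (x : E) :
    ‖similarity p j x - p i‖ ≤ 1 / 2 * ‖x - p i‖ + 1 / 2 * ‖p j - p i‖ := by
  rw [similarity_sub]
  refine (norm_add_le _ _).trans_eq ?_
  rw [norm_smul, norm_smul, Real.norm_of_nonneg (by norm_num)]

theorem bary_similarity (i j : Fin N) (x : E) :
    bary p i (similarity p j x) = 1 / 2 * bary p i x + 1 / 2 * bary p i (p j) := by
  unfold bary
  rw [similarity_sub, inner_add_left, real_inner_smul_left, real_inner_smul_left]
  ring

theorem bary_self (i : Fin N) : bary p i (p i) = 1 := by simp [bary]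

theorem inner_sub_sub_eq (hp : ∀ i j, i ≠ j → ‖p i - p j‖ = 1) {i j : Fin N} (hij : i ≠ j)
    (k : Fin N) : inner ℝ (p j - p i) (p k - p i) =
      1 / 2 * (1 + (if k = i then 0 else 1) - (if k = j then 0 else 1)) := by
  have norm_sq_eq (i j : Fin N) : ‖p i - p j‖ ^ 2 = if i = j then 0 else 1 := by
    split_ifs with hij
    · simp [hij]
    · rw [hp i j hij, one_pow]
  have polarisation := norm_sub_sq_real (p k - p i) (p j - p i)
  rw [sub_sub_sub_cancel_right, norm_sq_eq, norm_sq_eq, hp j i hij.symm,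
    real_inner_comm] at polarisation
  linarith

theorem bary_of_ne (hp : ∀ i j, i ≠ j → ‖p i - p j‖ = 1) {i j : Fin N} (hij : i ≠ j) :
    bary p i (p j) = 0 := by
  have hN : (N : ℝ) ≠ 0 := by
    have := i.pos
    positivity
  have card_ne (l : Fin N) : ∑ k : Fin N, (if k = l then (0 : ℝ) else 1) = N - 1 := by
    rw [← Finset.add_sum_erase _ _ (Finset.mem_univ l), Finset.sum_congr rfl fun k hk =>
      if_neg (Finset.ne_of_mem_erase hk)]
    simp [Finset.card_erase_of_mem, Nat.cast_pred i.pos]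
  have inner_sum_eq : inner ℝ (p j - p i) (∑ k, (p k - p i)) = (N / 2 : ℝ) := by
    rw [inner_sum, Finset.sum_congr rfl fun k _ => inner_sub_sub_eq hp hij k, ← Finset.mul_sum,
      Finset.sum_sub_distrib, Finset.sum_add_distrib, card_ne, card_ne, Finset.sum_const,
      Finset.card_univ, Fintype.card_fin, nsmul_eq_mul]
    ring
  rw [bary, inner_sum_eq]
  field_simp
  ring

theorem bary_nonneg_and_norm_sub_le (hp : ∀ i j, i ≠ j → ‖p i - p j‖ = 1) (i : Fin N) {x : E}
    (hx : x ∈ gasket p) : 0 ≤ bary p i x ∧ ‖x - p i‖ ≤ 1 - bary p i x := by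
  have closed : IsClosed {x | 0 ≤ bary p i x ∧ ‖x - p i‖ ≤ 1 - bary p i x} :=
    (isClosed_le continuous_const (continuous_bary i)).inter
      (isClosed_le (by fun_prop) (continuous_const.sub (continuous_bary i)))
  have vertex_mem (j : Fin N) : 0 ≤ bary p i (p j) ∧ ‖p j - p i‖ ≤ 1 - bary p i (p j) := by
    rcases eq_or_ne i j with rfl | hij
    · simp [bary_self]
    · simp [bary_of_ne hp hij, hp j i hij.symm]
  refine gasket_subset_of_isClosed closed vertex_mem (fun j x hx => ?_) hx
  have hj := vertex_mem j
  have norm_le := norm_similarity_sub_le (p := p) i j x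
  simp only [Set.mem_ofPred_eq] at hx ⊢
  rw [bary_similarity]
  exact ⟨by linarith [hx.1, hj.1], by linarith [hx.2, hj.2]⟩

/- On `F_i(V)` the coordinate `bary p i` is at least `1/2`, on `F_j(V)` at most `1/2`, and the value
`1/2` is attained on `F_j(V)` only at `F_j(p_i)`. -/
theorem eq_vertex_of_cellMap_eq (hp : ∀ i j, i ≠ j → ‖p i - p j‖ = 1) {i j : Fin N} (hij : i ≠ j)
    {x y : gasket p} (h : cellMap p i x = cellMap p j y) : y = vertex p i := by
  have bary_eq := congrArg (bary p i) (congrArg Subtype.val h)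
  simp only [cellMap, bary_similarity, bary_self, bary_of_ne hp hij] at bary_eq
  have hx := bary_nonneg_and_norm_sub_le hp i x.2
  have hy := bary_nonneg_and_norm_sub_le hp i y.2
  have : ‖(y : E) - p i‖ ≤ 0 := by linarith [hx.1, hy.2]
  exact Subtype.ext (sub_eq_zero.1 (norm_le_zero_iff.1 this))

theorem vertex_injective (hp : ∀ i j, i ≠ j → ‖p i - p j‖ = 1) :
    Function.Injective (vertex p) := by
  intro i j h
  by_contra hij
  have dist_eq_one := hp i j hij
  rw [show p i = p j from congrArg Subtype.val h, sub_self, norm_zero] at dist_eq_one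
  exact zero_ne_one dist_eq_one

open Classical in
/-- The pairs of distinct vertices of level `m` in a common cell. -/
def edges (p : Fin N → E) (m : ℕ) : Finset (gasket p × gasket p) :=
  (gasketLevel p m ×ˢ gasketLevel p m).filter fun q => q.1 ≠ q.2 ∧ SameCell p m q.1 q.2

theorem mem_edges {m : ℕ} {q : gasket p × gasket p} : q ∈ edges p m ↔
    q.1 ∈ gasketLevel p m ∧ q.2 ∈ gasketLevel p m ∧ q.1 ≠ q.2 ∧ SameCell p m q.1 q.2 := by
  classical
  simp [edges, and_assoc]

theorem levelEnergy_eq_sum_edges (m : ℕ) (u : gasket p → ℝ) :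
    levelEnergy p m u = 1 / 2 * (((N : ℝ) + 2) / N) ^ m * ∑ q ∈ edges p m, (u q.1 - u q.2) ^ 2 := by
  classical
  unfold levelEnergy edges
  rw [Finset.sum_filter, Finset.sum_product]
  congr 1
  refine Finset.sum_congr rfl fun x _ => Finset.sum_congr rfl fun y _ => ?_
  by_cases hxy : x = y
  · simp [hxy]
  · simp [hxy]

theorem mem_gasketLevel_of_cellMap_mem (hp : ∀ i j, i ≠ j → ‖p i - p j‖ = 1) {m : ℕ} {i : Fin N}
    {x : gasket p} (h : cellMap p i x ∈ gasketLevel p (m + 1)) : x ∈ gasketLevel p m := by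
  obtain ⟨j, y, hy, hyx⟩ := mem_gasketLevel_succ.1 h
  rcases eq_or_ne j i with rfl | hij
  · rwa [← cellMap_injective j hyx]
  · rw [eq_vertex_of_cellMap_eq hp hij hyx]
    exact vertex_mem_gasketLevel j m

theorem levelEnergy_zero (hp : ∀ i j, i ≠ j → ‖p i - p j‖ = 1) (u : gasket p → ℝ) :
    levelEnergy p 0 u = 1 / 2 * ∑ i, ∑ j, (u (vertex p i) - u (vertex p j)) ^ 2 := by
  classical
  have h : gasketLevel p 0 = Finset.univ.map ⟨vertex p, vertex_injective hp⟩ := by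
    ext x
    simp [mem_gasketLevel_zero]
  simp [levelEnergy, sameCell_zero, h]

theorem cellMap_mem_edges {m : ℕ} {q : gasket p × gasket p} (hq : q ∈ edges p m) (i : Fin N) :
    (cellMap p i q.1, cellMap p i q.2) ∈ edges p (m + 1) := by
  obtain ⟨hx, hy, hne, hcell⟩ := mem_edges.1 hq
  exact mem_edges.2 ⟨mem_gasketLevel_succ.2 ⟨i, q.1, hx, rfl⟩,
    mem_gasketLevel_succ.2 ⟨i, q.2, hy, rfl⟩, (cellMap_injective i).ne hne,
    sameCell_succ.2 ⟨i, q.1, q.2, rfl, rfl, hcell⟩⟩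

theorem exists_edge_of_mem_edges_succ (hp : ∀ i j, i ≠ j → ‖p i - p j‖ = 1) {m : ℕ}
    {q : gasket p × gasket p} (hq : q ∈ edges p (m + 1)) :
    ∃ i, ∃ r ∈ edges p m, (cellMap p i r.1, cellMap p i r.2) = q := by
  obtain ⟨x, y⟩ := q
  obtain ⟨hx, hy, hne, hcell⟩ := mem_edges.1 hq
  obtain ⟨i, x', y', rfl, rfl, hcell'⟩ := sameCell_succ.1 hcell
  exact ⟨i, (x', y'), mem_edges.2 ⟨mem_gasketLevel_of_cellMap_mem hp hx,
    mem_gasketLevel_of_cellMap_mem hp hy, fun h => hne (congrArg (cellMap p i) h), hcell'⟩, rfl⟩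

theorem index_eq_of_cellMap_eq (hp : ∀ i j, i ≠ j → ‖p i - p j‖ = 1) {i j : Fin N}
    {x y x' y' : gasket p} (hxy : x ≠ y) (hx : cellMap p i x = cellMap p j x')
    (hy : cellMap p i y = cellMap p j y') : i = j := by
  by_contra hij
  exact hxy ((eq_vertex_of_cellMap_eq hp (Ne.symm hij) hx.symm).trans
    (eq_vertex_of_cellMap_eq hp (Ne.symm hij) hy.symm).symm)

theorem sum_edges_succ (hp : ∀ i j, i ≠ j → ‖p i - p j‖ = 1) (m : ℕ)
    {M : Type*} [AddCommMonoid M] (f : gasket p × gasket p → M) :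
    ∑ q ∈ edges p (m + 1), f q =
      ∑ i, ∑ q ∈ edges p m, f (cellMap p i q.1, cellMap p i q.2) := by
  rw [← Finset.sum_product']
  symm
  refine Finset.sum_nbij (fun r => (cellMap p r.1 r.2.1, cellMap p r.1 r.2.2)) ?_ ?_ ?_
    fun _ _ => rfl
  · exact fun r hr => cellMap_mem_edges (Finset.mem_product.1 hr).2 r.1
  · rintro ⟨i, x, y⟩ hr ⟨j, x', y'⟩ - heq
    obtain ⟨-, -, hne, -⟩ := mem_edges.1 (Finset.mem_product.1 hr).2
    obtain ⟨hx, hy⟩ := Prod.mk.inj heq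
    obtain rfl := index_eq_of_cellMap_eq hp hne hx hy
    exact Prod.ext rfl (Prod.ext (cellMap_injective i hx) (cellMap_injective i hy))
  · intro q hq
    obtain ⟨i, r, hr, rfl⟩ := exists_edge_of_mem_edges_succ hp hq
    exact ⟨(i, r), Finset.mem_product.2 ⟨Finset.mem_univ _, hr⟩, rfl⟩

theorem levelEnergy_succ (hp : ∀ i j, i ≠ j → ‖p i - p j‖ = 1) (m : ℕ) (u : gasket p → ℝ) :
    levelEnergy p (m + 1) u =
      ((N : ℝ) + 2) / N * ∑ i, levelEnergy p m (fun x => u (cellMap p i x)) := by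
  simp only [levelEnergy_eq_sum_edges]
  rw [sum_edges_succ hp, ← Finset.mul_sum, pow_succ]
  ring

end Simplex

section Harmonic

variable {N : ℕ}

/-- The harmonic extension of the boundary values `c` to `V_1`: its value at the vertex
`F_i(p_j) = F_j(p_i)`. -/
def harmonicStep (c : Fin N → ℝ) (i j : Fin N) : ℝ :=
  if i = j then c i else (c i + c j + ∑ k, c k) / (N + 2)

theorem harmonicStep_self (c : Fin N → ℝ) (i : Fin N) : harmonicStep c i i = c i := if_pos rfl

theorem harmonicStep_of_ne (c : Fin N → ℝ) {i j : Fin N} (hij : i ≠ j) :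
    harmonicStep c i j = (c i + c j + ∑ k, c k) / (N + 2) := if_neg hij

theorem harmonicStep_comm (c : Fin N → ℝ) (i j : Fin N) :
    harmonicStep c i j = harmonicStep c j i := by
  rcases eq_or_ne i j with rfl | hij
  · rfl
  · rw [harmonicStep_of_ne c hij, harmonicStep_of_ne c hij.symm, add_comm (c i)]

theorem sum_sum_sub_mul_sub (a b : Fin N → ℝ) :
    ∑ j, ∑ k, (a j - a k) * (b j - b k) = 2 * ∑ j, b j * (N * a j - ∑ k, a k) := by
  have expand (j k : Fin N) : (a j - a k) * (b j - b k) =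
      (b j * a j - b j * a k) + (b k * a k - b k * a j) := by ring
  simp only [expand, Finset.sum_add_distrib]
  rw [Finset.sum_comm (f := fun j k => b k * a k - b k * a j), ← two_mul]
  congr 1
  refine Finset.sum_congr rfl fun j _ => ?_
  rw [Finset.sum_sub_distrib, Finset.sum_const, Finset.card_univ, Fintype.card_fin, nsmul_eq_mul,
    ← Finset.mul_sum]
  ring

theorem sum_sum_eq_zero_of_antisymm {ι : Type*} [Fintype ι] {f : ι → ι → ℝ}
    (hf : ∀ i j, f i j = -f j i) : ∑ i, ∑ j, f i j = 0 := by
  have eq_neg : ∑ i, ∑ j, f i j = -∑ i, ∑ j, f i j := by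
    conv_lhs => rw [Finset.sum_comm]
    simp only [← Finset.sum_neg_distrib, ← hf]
  linarith

theorem sum_harmonicStep (c : Fin N → ℝ) (i : Fin N) :
    ∑ k, harmonicStep c i k = (2 * N * c i + N * ∑ k, c k) / (N + 2) := by
  have expand (k : Fin N) : harmonicStep c i k = (c i + c k + ∑ l, c l) / (N + 2) +
      if i = k then c i - (2 * c i + ∑ l, c l) / (N + 2) else 0 := by
    rcases eq_or_ne i k with rfl | hk
    · rw [harmonicStep_self, if_pos rfl]; ring
    · rw [harmonicStep_of_ne c hk, if_neg hk, add_zero]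
  have hN : (N : ℝ) + 2 ≠ 0 := by positivity
  simp only [expand, Finset.sum_add_distrib, ← Finset.sum_div, Finset.sum_const, Finset.card_univ,
    Fintype.card_fin, nsmul_eq_mul, Finset.sum_ite_eq, Finset.mem_univ, if_true]
  field_simp
  ring

theorem card_mul_harmonicStep_sub_sum (c : Fin N → ℝ) (i j : Fin N) :
    N * harmonicStep c i j - ∑ k, harmonicStep c i k = N / (N + 2) * (c j - c i) +
      if i = j then N / (N + 2) * (N * c i - ∑ k, c k) else 0 := by
  have hN : (N : ℝ) + 2 ≠ 0 := by positivity
  rw [sum_harmonicStep]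
  rcases eq_or_ne i j with rfl | hij
  · rw [harmonicStep_self, if_pos rfl]; field_simp; ring
  · rw [harmonicStep_of_ne c hij, if_neg hij]; field_simp; ring

/- Harmonicity: the polarised energy of a harmonic extension sees only the boundary values of the
other function. -/
theorem sum_harmonicStep_mul (c : Fin N → ℝ) {x : Fin N → Fin N → ℝ}
    (hx : ∀ i j, x i j = x j i) :
    ∑ i, ∑ j, ∑ k, (harmonicStep c i j - harmonicStep c i k) * (x i j - x i k) =
      2 * (N / (N + 2)) * ∑ i, x i i * (N * c i - ∑ k, c k) := by
  have antisymm_part : ∑ i, ∑ j, x i j * (N / (N + 2) * (c j - c i)) = 0 :=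
    sum_sum_eq_zero_of_antisymm fun i j => by rw [hx j i]; ring
  have row_sum (i : Fin N) : ∑ j, x i j * (N * harmonicStep c i j - ∑ k, harmonicStep c i k) =
      ∑ j, x i j * (N / (N + 2) * (c j - c i)) +
        N / (N + 2) * (x i i * (N * c i - ∑ k, c k)) := by
    simp only [card_mul_harmonicStep_sub_sum, mul_add, Finset.sum_add_distrib, mul_ite, mul_zero,
      Finset.sum_ite_eq, Finset.mem_univ, if_true]
    ring
  simp only [sum_sum_sub_mul_sub]
  rw [← Finset.mul_sum, Finset.sum_congr rfl fun i _ => row_sum i, Finset.sum_add_distrib,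
    antisymm_part, ← Finset.mul_sum, zero_add, mul_assoc]

theorem sum_sub_sq_eq_harmonicStep (hN : 0 < N) (c : Fin N → ℝ) :
    ∑ j, ∑ k, (c j - c k) ^ 2 = ((N : ℝ) + 2) / N *
      ∑ i, ∑ j, ∑ k, (harmonicStep c i j - harmonicStep c i k) ^ 2 := by
  have hN' : (N : ℝ) ≠ 0 := by positivity
  simp only [sq]
  rw [sum_harmonicStep_mul c (harmonicStep_comm c), sum_sum_sub_mul_sub]
  simp only [harmonicStep_self]
  field_simp
  simp only [mul_comm]

theorem sum_harmonicStep_sub_sq_le {x : Fin N → Fin N → ℝ} (hx : ∀ i j, x i j = x j i) :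
    ∑ i, ∑ j, ∑ k, (harmonicStep (fun l => x l l) i j - harmonicStep (fun l => x l l) i k) ^ 2 ≤
      ∑ i, ∑ j, ∑ k, (x i j - x i k) ^ 2 := by
  set h := harmonicStep fun l => x l l
  have orthogonal : ∑ i, ∑ j, ∑ k, (h i j - h i k) * (x i j - x i k) =
      ∑ i, ∑ j, ∑ k, (h i j - h i k) ^ 2 := by
    simp only [sq]
    rw [sum_harmonicStep_mul _ hx, sum_harmonicStep_mul _ (harmonicStep_comm _)]
    simp only [harmonicStep_self]
  have young : ∑ i, ∑ j, ∑ k, (2 * ((h i j - h i k) * (x i j - x i k)) - (h i j - h i k) ^ 2) ≤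
      ∑ i, ∑ j, ∑ k, (x i j - x i k) ^ 2 :=
    Finset.sum_le_sum fun i _ => Finset.sum_le_sum fun j _ => Finset.sum_le_sum fun k _ => by
      linarith [two_mul_le_add_sq (h i j - h i k) (x i j - x i k)]
  simp only [Finset.sum_sub_distrib, ← Finset.mul_sum] at young
  linarith

theorem sum_sub_sq_le (hN : 0 < N) {x : Fin N → Fin N → ℝ} (hx : ∀ i j, x i j = x j i) :
    ∑ j, ∑ k, (x j j - x k k) ^ 2 ≤
      ((N : ℝ) + 2) / N * ∑ i, ∑ j, ∑ k, (x i j - x i k) ^ 2 := by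
  rw [sum_sub_sq_eq_harmonicStep hN fun l => x l l]
  gcongr ?_ * ?_
  exact sum_harmonicStep_sub_sq_le hx

end Harmonic

section Energy

variable {E : Type*} [NormedAddCommGroup E] [InnerProductSpace ℝ E] {N : ℕ} {p : Fin N → E}

theorem levelEnergy_nonneg (m : ℕ) (u : gasket p → ℝ) : 0 ≤ levelEnergy p m u := by
  rw [levelEnergy_eq_sum_edges]
  have : 0 ≤ ∑ q ∈ edges p m, (u q.1 - u q.2) ^ 2 := Finset.sum_nonneg fun _ _ => sq_nonneg _
  positivity

theorem continuous_levelEnergy (m : ℕ) : Continuous fun u : gasket p → ℝ => levelEnergy p m u := by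
  simp only [levelEnergy_eq_sum_edges]
  fun_prop

theorem convexOn_levelEnergy (m : ℕ) : ConvexOn ℝ Set.univ (levelEnergy p m) := by
  have edge (q : gasket p × gasket p) :
      ConvexOn ℝ Set.univ fun u : gasket p → ℝ => (u q.1 - u q.2) ^ 2 := by
    let eval (x : gasket p) : (gasket p → ℝ) →ₗ[ℝ] ℝ := LinearMap.proj x
    exact (even_two.convexOn_pow (𝕜 := ℝ)).comp_linearMap (eval q.1 - eval q.2)
  have sum_edges : ConvexOn ℝ Set.univ fun u : gasket p → ℝ =>
      ∑ q ∈ edges p m, (u q.1 - u q.2) ^ 2 := by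
    convert Finset.sum_induction (fun q (u : gasket p → ℝ) => (u q.1 - u q.2) ^ 2)
      (ConvexOn ℝ Set.univ) (s := edges p m) (fun _ _ => ConvexOn.add)
      (convexOn_const 0 convex_univ) fun q _ => edge q using 1
    ext u
    rw [Finset.sum_apply]
  rw [show levelEnergy p m = _ from funext (levelEnergy_eq_sum_edges m)]
  exact sum_edges.smul (by positivity)

theorem monotone_levelEnergy (hp : ∀ i j, i ≠ j → ‖p i - p j‖ = 1) (hN : 0 < N)
    (u : gasket p → ℝ) : Monotone fun m => levelEnergy p m u := by
  refine monotone_nat_of_le_succ fun m => ?_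
  induction m generalizing u with
  | zero =>
    have trace_le := sum_sub_sq_le hN (x := fun i j => u (cellMap p i (vertex p j)))
      fun i j => by rw [cellMap_vertex_comm]
    simp only [cellMap_vertex] at trace_le
    rw [levelEnergy_succ hp, levelEnergy_zero hp]
    simp only [levelEnergy_zero hp]
    rw [← Finset.mul_sum]
    linarith
  | succ m ih =>
    rw [levelEnergy_succ hp, levelEnergy_succ hp (m + 1)]
    gcongr with i
    exact ih _

theorem tendsto_levelEnergy (hp : ∀ i j, i ≠ j → ‖p i - p j‖ = 1) (hN : 0 < N)
    (u : gasket p → ℝ) :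
    Tendsto (fun m => ENNReal.ofReal (levelEnergy p m u)) atTop (𝓝 (energy p u)) :=
  tendsto_nhds_limUnder ⟨_, tendsto_atTop_iSup fun _ _ h =>
    ENNReal.ofReal_le_ofReal (monotone_levelEnergy hp hN u h)⟩

theorem energy_eq_iSup (hp : ∀ i j, i ≠ j → ‖p i - p j‖ = 1) (hN : 0 < N) (u : gasket p → ℝ) :
    energy p u = ⨆ m, ENNReal.ofReal (levelEnergy p m u) :=
  tendsto_nhds_unique (tendsto_levelEnergy hp hN u) (tendsto_atTop_iSup fun _ _ h =>
    ENNReal.ofReal_le_ofReal (monotone_levelEnergy hp hN u h))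

theorem energy_le_ofReal_iff (hp : ∀ i j, i ≠ j → ‖p i - p j‖ = 1) (hN : 0 < N)
    {u : gasket p → ℝ} {C : ℝ} (hC : 0 ≤ C) :
    energy p u ≤ ENNReal.ofReal C ↔ ∀ m, levelEnergy p m u ≤ C := by
  rw [energy_eq_iSup hp hN, iSup_le_iff]
  exact forall_congr' fun m => ENNReal.ofReal_le_ofReal_iff hC

theorem energy_zero : energy p 0 = 0 := by
  refine Tendsto.limUnder_eq (tendsto_const_nhds.congr fun m => ?_)
  simp [levelEnergy_eq_sum_edges]

theorem energy_neg (u : gasket p → ℝ) : energy p (-u) = energy p u := by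
  unfold energy
  simp only [levelEnergy_eq_sum_edges, Pi.neg_apply, neg_sub_neg, sub_sq_comm]

theorem energy_add_le (hp : ∀ i j, i ≠ j → ‖p i - p j‖ = 1) (hN : 0 < N)
    {u v u' v' : gasket p → ℝ} (h : ∀ x y, (u' x - u' y) ^ 2 + (v' x - v' y) ^ 2 ≤
      (u x - u y) ^ 2 + (v x - v y) ^ 2) :
    energy p u' + energy p v' ≤ energy p u + energy p v := by
  refine le_of_tendsto_of_tendsto'
    ((tendsto_levelEnergy hp hN u').add (tendsto_levelEnergy hp hN v'))
    ((tendsto_levelEnergy hp hN u).add (tendsto_levelEnergy hp hN v)) fun m => ?_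
  simp only [← ENNReal.ofReal_add (levelEnergy_nonneg m _) (levelEnergy_nonneg m _)]
  apply ENNReal.ofReal_le_ofReal
  simp only [levelEnergy_eq_sum_edges, ← mul_add, ← Finset.sum_add_distrib]
  exact mul_le_mul_of_nonneg_left (Finset.sum_le_sum fun _ _ => h _ _) (by positivity)

theorem convexOn_energy (hp : ∀ i j, i ≠ j → ‖p i - p j‖ = 1) (hN : 0 < N) :
    ConvexOn ℝ≥0 Set.univ fun u : gasket p → ℝ => energy p u := by
  refine ⟨convex_univ, fun u _ v _ a b _ _ hab => ?_⟩
  refine le_of_tendsto_of_tendsto' (tendsto_levelEnergy hp hN _)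
    ((ENNReal.Tendsto.const_mul (tendsto_levelEnergy hp hN u) (Or.inr ENNReal.coe_ne_top)).add
      (ENNReal.Tendsto.const_mul (tendsto_levelEnergy hp hN v) (Or.inr ENNReal.coe_ne_top)))
    fun m => ?_
  rw [← ENNReal.ofReal_coe_nnreal, ← ENNReal.ofReal_coe_nnreal,
    ← ENNReal.ofReal_mul a.coe_nonneg, ← ENNReal.ofReal_mul b.coe_nonneg,
    ← ENNReal.ofReal_add (mul_nonneg a.coe_nonneg (levelEnergy_nonneg _ _))
      (mul_nonneg b.coe_nonneg (levelEnergy_nonneg _ _))]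
  exact ENNReal.ofReal_le_ofReal ((convexOn_levelEnergy m).2 (Set.mem_univ u) (Set.mem_univ v)
    a.coe_nonneg b.coe_nonneg (by exact_mod_cast hab))

theorem lowerSemicontinuous_energy (hp : ∀ i j, i ≠ j → ‖p i - p j‖ = 1) (hN : 0 < N) :
    LowerSemicontinuous fun u : gasket p → ℝ => energy p u := by
  simp only [energy_eq_iSup hp hN]
  exact lowerSemicontinuous_iSup fun m =>
    (ENNReal.continuous_ofReal.comp (continuous_levelEnergy m)).lowerSemicontinuous

end Energy

section Oscillation

variable {E : Type*} [NormedAddCommGroup E] [InnerProductSpace ℝ E] {N : ℕ} {p : Fin N → E}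

theorem levelEnergy_comp_cellMap_le (hp : ∀ i j, i ≠ j → ‖p i - p j‖ = 1) (m : ℕ)
    (u : gasket p → ℝ) (i : Fin N) :
    levelEnergy p m (fun x => u (cellMap p i x)) ≤ N / (N + 2) * levelEnergy p (m + 1) u := by
  have hN : (0 : ℝ) < N := by exact_mod_cast i.pos
  rw [levelEnergy_succ hp, ← mul_assoc, div_mul_div_cancel₀ (by positivity), div_self hN.ne',
    one_mul]
  exact Finset.single_le_sum (f := fun i => levelEnergy p m fun x => u (cellMap p i x))
    (fun i _ => levelEnergy_nonneg m _) (Finset.mem_univ i)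

theorem levelEnergy_comp_cellWord_le (hp : ∀ i j, i ≠ j → ‖p i - p j‖ = 1) {C : ℝ}
    (w : List (Fin N)) {u : gasket p → ℝ} (hu : ∀ m, levelEnergy p m u ≤ C) (m : ℕ) :
    levelEnergy p m (fun x => u (cellWord p w x)) ≤ (N / (N + 2)) ^ w.length * C := by
  induction w generalizing u C with
  | nil => simpa [cellWord] using hu m
  | cons i w ih =>
    rw [List.length_cons, pow_succ, mul_assoc]
    refine ih (u := fun x => u (cellMap p i x)) fun m => ?_
    exact (levelEnergy_comp_cellMap_le hp m u i).trans (by gcongr; exact hu (m + 1))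

theorem sq_sub_vertex_le (hp : ∀ i j, i ≠ j → ‖p i - p j‖ = 1) (u : gasket p → ℝ)
    (i j : Fin N) : (u (vertex p i) - u (vertex p j)) ^ 2 ≤ 2 * levelEnergy p 0 u := by
  have le_row := Finset.single_le_sum (f := fun j => (u (vertex p i) - u (vertex p j)) ^ 2)
    (fun j _ => sq_nonneg _) (Finset.mem_univ j)
  have row_le := Finset.single_le_sum
    (f := fun i => ∑ j, (u (vertex p i) - u (vertex p j)) ^ 2)
    (fun i _ => Finset.sum_nonneg fun j _ => sq_nonneg _) (Finset.mem_univ i)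
  rw [levelEnergy_zero hp]
  linarith [le_row.trans row_le]

theorem abs_sub_vertex_vertex_le (hp : ∀ i j, i ≠ j → ‖p i - p j‖ = 1) {C : ℝ}
    {u : gasket p → ℝ} (hu : levelEnergy p 0 u ≤ C) (i j : Fin N) :
    |u (vertex p i) - u (vertex p j)| ≤ √(2 * C) :=
  Real.abs_le_sqrt ((sq_sub_vertex_le hp u i j).trans (by gcongr))

/-- The sum of the geometric series with ratio `√(N / (N + 2))`, the factor by which the
oscillation of functions of given energy decreases from one level of cells to the next. -/
def oscConst (N : ℕ) : ℝ := (1 - √((N : ℝ) / (N + 2)))⁻¹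

theorem one_sub_sqrt_pos (N : ℕ) : 0 < 1 - √((N : ℝ) / (N + 2)) := by
  rw [sub_pos, Real.sqrt_lt' one_pos, one_pow, div_lt_one (by positivity)]
  linarith

theorem oscConst_nonneg (N : ℕ) : 0 ≤ oscConst N := (inv_pos.2 (one_sub_sqrt_pos N)).le

theorem oscConst_eq (N : ℕ) : oscConst N = √((N : ℝ) / (N + 2)) * oscConst N + 1 := by
  have := mul_inv_cancel₀ (one_sub_sqrt_pos N).ne'
  unfold oscConst
  linarith

/- Chaining: a vertex of level `n` is joined to `V_0` by one edge of each level. -/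
theorem abs_sub_vertex_le (hp : ∀ i j, i ≠ j → ‖p i - p j‖ = 1) (n : ℕ) {C : ℝ}
    {u : gasket p → ℝ} (hu : ∀ m, levelEnergy p m u ≤ C) {x : gasket p}
    (hx : x ∈ gasketLevel p n) (j : Fin N) :
    |u x - u (vertex p j)| ≤ oscConst N * √(2 * C) := by
  have edge_le (i : Fin N) := abs_sub_vertex_vertex_le hp (hu 0) i j
  rw [oscConst_eq, add_mul, one_mul]
  induction n generalizing C u x j with
  | zero =>
    obtain ⟨i, rfl⟩ := mem_gasketLevel_zero.1 hx
    exact (edge_le i).trans (le_add_of_nonneg_left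
      (mul_nonneg (mul_nonneg (Real.sqrt_nonneg _) (oscConst_nonneg N)) (Real.sqrt_nonneg _)))
  | succ n ih =>
    obtain ⟨i, y, hy, rfl⟩ := mem_gasketLevel_succ.1 hx
    have energy_le (m : ℕ) : levelEnergy p m (fun z => u (cellMap p i z)) ≤ N / (N + 2) * C :=
      (levelEnergy_comp_cellMap_le hp m u i).trans (by gcongr; exact hu (m + 1))
    have cell_le := ih energy_le hy i fun k => abs_sub_vertex_vertex_le hp (energy_le 0) k i
    rw [← one_mul √(2 * (_ * C)), ← mul_assoc, mul_one, ← add_mul, ← oscConst_eq, cellMap_vertex,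
      mul_left_comm, Real.sqrt_mul (by positivity), ← mul_assoc,
      mul_comm (oscConst N)] at cell_le
    exact (abs_sub_le _ _ _).trans (add_le_add cell_le (edge_le i))

/-- A bound for the oscillation on cells of level `m` of functions with energy at most `C`. -/
def oscBound (N : ℕ) (C : ℝ) (m : ℕ) : ℝ := 2 * (oscConst N * √(2 * ((N / (N + 2)) ^ m * C)))

theorem tendsto_oscBound (N : ℕ) (C : ℝ) : Tendsto (oscBound N C) atTop (𝓝 0) := by
  have pow_tendsto : Tendsto (fun m : ℕ => ((N : ℝ) / (N + 2)) ^ m) atTop (𝓝 0) :=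
    tendsto_pow_atTop_nhds_zero_of_lt_one (by positivity) (by
      rw [div_lt_one (by positivity)]; linarith)
  have := (((pow_tendsto.mul_const C).const_mul 2).sqrt.const_mul (oscConst N)).const_mul 2
  simpa only [zero_mul, mul_zero, Real.sqrt_zero, ← oscBound.eq_def] using this

theorem abs_sub_le_oscBound (hp : ∀ i j, i ≠ j → ‖p i - p j‖ = 1) (hN : 0 < N) {C : ℝ}
    {u : gasket p → ℝ} (hcont : Continuous u) (hu : ∀ m, levelEnergy p m u ≤ C)
    (w : List (Fin N)) (x y : gasket p) :
    |u (cellWord p w x) - u (cellWord p w y)| ≤ oscBound N C w.length := by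
  set v : gasket p → ℝ := fun z => u (cellWord p w z)
  have hv : Continuous v := hcont.comp (continuous_cellWord w)
  set s : Set (gasket p) := {z | |v z - v (vertex p ⟨0, hN⟩)| ≤
    oscConst N * √(2 * ((N / (N + 2)) ^ w.length * C))}
  have closed : IsClosed s := isClosed_le (by fun_prop) continuous_const
  have levels_subset : (⋃ n, (gasketLevel p n : Set (gasket p))) ⊆ s := Set.iUnion_subset
    fun n z hz => abs_sub_vertex_le hp n (levelEnergy_comp_cellWord_le hp w hu) hz _
  have mem_s (z : gasket p) : z ∈ s :=
    closure_minimal levels_subset closed (dense_iUnion_gasketLevel z)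
  calc |v x - v y| ≤ |v x - v (vertex p ⟨0, hN⟩)| + |v (vertex p ⟨0, hN⟩) - v y| :=
      abs_sub_le _ _ _
    _ ≤ _ := add_le_add (mem_s x) ((abs_sub_comm _ _).trans_le (mem_s y))
    _ = oscBound N C w.length := (two_mul _).symm

end Oscillation

section Equicontinuity

theorem exists_continuous_limit_of_equicontinuous {X α : Type*} [TopologicalSpace X]
    [PseudoMetricSpace α] [CompleteSpace α] {F : ℕ → X → α} (hF : Equicontinuous F) {s : Set X}
    (hs : Dense s) (hcauchy : ∀ y ∈ s, CauchySeq fun n => F n y) :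
    ∃ f : X → α, Continuous f ∧ Tendsto F atTop (𝓝 f) := by
  have cauchy (x : X) : CauchySeq fun n => F n x := by
    refine Metric.cauchySeq_iff.2 fun ε hε => ?_
    obtain ⟨y, hxy, hys⟩ := mem_closure_iff_nhds.1 (hs x) _
      (Metric.equicontinuousAt_iff_right.1 (hF x) (ε / 3) (by positivity))
    obtain ⟨K, hK⟩ := Metric.cauchySeq_iff.1 (hcauchy y hys) (ε / 3) (by positivity)
    refine ⟨K, fun m hm n hn => (dist_triangle4_right _ _ (F m y) (F n y)).trans_lt ?_⟩
    linarith [hxy m, hxy n, hK m hm n hn]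
  choose f hf using fun x => cauchySeq_tendsto_of_complete (cauchy x)
  have tendsto_f : Tendsto F atTop (𝓝 f) := tendsto_pi_nhds.2 hf
  exact ⟨f, tendsto_f.continuous_of_equicontinuous hF, tendsto_f⟩

variable {E : Type*} [NormedAddCommGroup E] [InnerProductSpace ℝ E] [ProperSpace E] {N : ℕ}
  {p : Fin N → E}

theorem equicontinuous_of_levelEnergy_le (hp : ∀ i j, i ≠ j → ‖p i - p j‖ = 1) (hN : 0 < N)
    {ι : Type*} {g : ι → C(gasket p, ℝ)} {C : ℝ} (hg : ∀ n m, levelEnergy p m (g n) ≤ C) :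
    Equicontinuous fun n => (g n : gasket p → ℝ) := by
  refine fun x => Metric.equicontinuousAt_iff_right.2 fun ε hε => ?_
  obtain ⟨m, hm⟩ := ((tendsto_oscBound N C).eventually_lt_const hε).exists
  filter_upwards [eventually_mem_cell m x] with y hy n
  obtain ⟨w, x', y', rfl, rfl, rfl⟩ := hy
  exact (abs_sub_le_oscBound hp hN (g n).continuous (hg n) w x' y').trans_lt hm

end Equicontinuity

section Perturbed

variable {E : Type*} [NormedAddCommGroup E] [InnerProductSpace ℝ E] {N : ℕ} {p : Fin N → E}
  [MeasurableSpace E] {μ : Measure (gasket p)} {B B₁ B₂ : Fin N → ℝ → ℝ≥0∞}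

theorem exists_of_perturbedEnergy_ne_top {u : Lp ℝ 2 μ} (h : perturbedEnergy p μ B u ≠ ⊤) :
    ∃ g : C(gasket p, ℝ), g ∈ H1 p ∧ u =ᵐ[μ] g := by
  by_contra hcon
  exact h (by rw [perturbedEnergy, dif_neg hcon])

variable [μ.IsOpenPosMeasure]

theorem perturbedEnergy_zero (hB : ∀ i, B i 0 = 0) : perturbedEnergy p μ B 0 = 0 := by
  have h0 : energy p (0 : C(gasket p, ℝ)) = 0 := energy_zero
  rw [perturbedEnergy_eq p μ B 0 0 (h0.trans_lt ENNReal.zero_lt_top) (Lp.coeFn_zero _ _ _), h0]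
  simp [hB]

theorem perturbedEnergy_comp_neg (B : Fin N → ℝ → ℝ≥0∞) :
    (fun u => perturbedEnergy p μ B (-u)) = perturbedEnergy p μ fun i s => B i (-s) := by
  have ge (B : Fin N → ℝ → ℝ≥0∞) (u : Lp ℝ 2 μ) :
      perturbedEnergy p μ (fun i s => B i (-s)) u ≤ perturbedEnergy p μ B (-u) := by
    rcases eq_or_ne (perturbedEnergy p μ B (-u)) ⊤ with hu | hu
    · exact hu ▸ le_top
    obtain ⟨f, hf, huf⟩ := exists_of_perturbedEnergy_ne_top hu
    have hE : energy p (-f : C(gasket p, ℝ)) = energy p f := energy_neg f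
    have hu' : u =ᵐ[μ] (-f : C(gasket p, ℝ)) := by
      filter_upwards [huf, Lp.coeFn_neg u] with x hfx hneg
      rw [ContinuousMap.neg_apply, ← hfx, hneg, Pi.neg_apply, neg_neg]
    rw [perturbedEnergy_eq p μ _ u (-f) (hE.trans_lt hf) hu', perturbedEnergy_eq p μ B _ f hf huf,
      hE]
    simp only [ContinuousMap.neg_apply, neg_neg, le_refl]
  funext u
  refine le_antisymm ?_ (ge B u)
  simpa only [neg_neg] using ge (fun i s => B i (-s)) (-u)

theorem perturbedEnergy_add_le (hp : ∀ i j, i ≠ j → ‖p i - p j‖ = 1) (hN : 0 < N)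
    {a b a' b' : Lp ℝ 2 μ}
    (h : ∀ f g : C(gasket p, ℝ), a =ᵐ[μ] f → b =ᵐ[μ] g → ∃ f' g' : C(gasket p, ℝ),
      a' =ᵐ[μ] f' ∧ b' =ᵐ[μ] g' ∧
      (∀ x y, (f' x - f' y) ^ 2 + (g' x - g' y) ^ 2 ≤ (f x - f y) ^ 2 + (g x - g y) ^ 2) ∧
      ∀ i, B₁ i (f' (vertex p i)) + B₂ i (g' (vertex p i)) ≤
        B₁ i (f (vertex p i)) + B₂ i (g (vertex p i))) :
    perturbedEnergy p μ B₁ a' + perturbedEnergy p μ B₂ b' ≤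
      perturbedEnergy p μ B₁ a + perturbedEnergy p μ B₂ b := by
  rcases eq_or_ne (perturbedEnergy p μ B₁ a) ⊤ with ha | ha
  · simp only [ha, top_add, le_top]
  rcases eq_or_ne (perturbedEnergy p μ B₂ b) ⊤ with hb | hb
  · simp only [hb, add_top, le_top]
  obtain ⟨f, hf, haf⟩ := exists_of_perturbedEnergy_ne_top ha
  obtain ⟨g, hg, hbg⟩ := exists_of_perturbedEnergy_ne_top hb
  obtain ⟨f', g', haf', hbg', hsq, hB⟩ := h f g haf hbg
  have hE := energy_add_le hp hN hsq
  obtain ⟨hf', hg'⟩ := ENNReal.add_lt_top.1 (hE.trans_lt (ENNReal.add_lt_top.2 ⟨hf, hg⟩))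
  rw [perturbedEnergy_eq p μ B₁ a f hf haf, perturbedEnergy_eq p μ B₂ b g hg hbg,
    perturbedEnergy_eq p μ B₁ a' f' hf' haf', perturbedEnergy_eq p μ B₂ b' g' hg' hbg',
    add_add_add_comm, add_add_add_comm (energy p f), ← Finset.sum_add_distrib,
    ← Finset.sum_add_distrib]
  exact add_le_add hE (Finset.sum_le_sum fun i _ => hB i)

theorem isSubmodular_of_linearOrder {α : Type*} [LinearOrder α] (f : α → ℝ≥0∞) :
    IsSubmodular f := fun a b => by
  rcases le_total a b with hab | hab
  · rw [inf_eq_left.2 hab, sup_eq_right.2 hab]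
  · rw [inf_eq_right.2 hab, sup_eq_left.2 hab, add_comm]

theorem isSubmodular_perturbedEnergy (hp : ∀ i j, i ≠ j → ‖p i - p j‖ = 1) (hN : 0 < N)
    (B : Fin N → ℝ → ℝ≥0∞) : IsSubmodular (perturbedEnergy p μ B) := fun a b => by
  refine perturbedEnergy_add_le hp hN fun f g haf hbg => ⟨f ⊓ g, f ⊔ g, ?_, ?_,
    fun x y => sq_inf_sub_inf_add_sq_sup_sub_sup_le _ _ _ _,
    fun i => isSubmodular_of_linearOrder (B i) _ _⟩
  · exact (Lp.coeFn_inf a b).trans (haf.inf hbg)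
  · exact (Lp.coeFn_sup a b).trans (haf.sup hbg)

theorem nonneg_of_ae_eq {b : Lp ℝ 2 μ} (hb : 0 ≤ b) {g : C(gasket p, ℝ)} (hbg : b =ᵐ[μ] g)
    (x : gasket p) : 0 ≤ g x := by
  have h : (fun x => g x ⊔ 0) = g := by
    refine (Continuous.ae_eq_iff_eq μ (by fun_prop) g.continuous).1 ?_
    filter_upwards [hbg, (Lp.coeFn_nonneg b).2 hb] with x hgx hbx
    rw [← hgx]
    exact sup_eq_left.2 hbx
  rw [← congrFun h x]
  exact le_sup_right

theorem truncationDominated_perturbedEnergy (hp : ∀ i j, i ≠ j → ‖p i - p j‖ = 1) (hN : 0 < N)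
    (hB : ∀ i, TruncationDominated (B₁ i) (B₂ i)) :
    TruncationDominated (perturbedEnergy p μ B₁) (perturbedEnergy p μ B₂) := fun a b hb => by
  refine perturbedEnergy_add_le hp hN fun f g haf hbg => ?_
  have hg := nonneg_of_ae_eq hb hbg
  refine ⟨(f ⊓ g) ⊔ -g, |f| ⊔ g, ?_, ?_,
    fun x y => sq_truncation_sub_add_sq_sub_le (hg x) (hg y), fun i => hB i _ _ (hg _)⟩
  · exact (Lp.coeFn_sup _ _).trans
      (((Lp.coeFn_inf a b).trans (haf.inf hbg)).sup ((Lp.coeFn_neg b).trans hbg.neg))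
  · exact (Lp.coeFn_sup _ _).trans (((Lp.coeFn_abs a).trans (haf.fun_comp abs)).sup hbg)

theorem convexOn_perturbedEnergy (hp : ∀ i j, i ≠ j → ‖p i - p j‖ = 1) (hN : 0 < N)
    (hB : ∀ i, ConvexOn ℝ≥0 Set.univ (B i)) :
    ConvexOn ℝ≥0 Set.univ (perturbedEnergy p μ B) := by
  refine convexOn_iff_forall_pos.2 ⟨convex_univ, fun u _ v _ a b ha hb hab => ?_⟩
  rcases eq_or_ne (perturbedEnergy p μ B u) ⊤ with hu | hu
  · rw [hu, ENNReal.smul_top, if_neg ha.ne', top_add]; exact le_top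
  rcases eq_or_ne (perturbedEnergy p μ B v) ⊤ with hv | hv
  · rw [hv, ENNReal.smul_top, if_neg hb.ne', add_top]; exact le_top
  obtain ⟨f, hf, huf⟩ := exists_of_perturbedEnergy_ne_top hu
  obtain ⟨g, hg, hvg⟩ := exists_of_perturbedEnergy_ne_top hv
  set k : C(gasket p, ℝ) := a • f + b • g
  have hE : energy p k ≤ a • energy p f + b • energy p g :=
    (convexOn_energy hp hN).2 (Set.mem_univ _) (Set.mem_univ _) ha.le hb.le hab
  have hk : k ∈ H1 p := hE.trans_lt (ENNReal.add_lt_top.2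
    ⟨ENNReal.mul_lt_top ENNReal.coe_lt_top hf, ENNReal.mul_lt_top ENNReal.coe_lt_top hg⟩)
  have huv : (a • u + b • v : Lp ℝ 2 μ) =ᵐ[μ] k :=
    (Lp.coeFn_add _ _).trans (((Lp.coeFn_smul (a : ℝ) u).trans (huf.const_smul (a : ℝ))).add
      ((Lp.coeFn_smul (b : ℝ) v).trans (hvg.const_smul (b : ℝ))))
  rw [perturbedEnergy_eq p μ B _ k hk huv, perturbedEnergy_eq p μ B u f hf huf,
    perturbedEnergy_eq p μ B v g hg hvg, smul_add, smul_add, add_add_add_comm, Finset.smul_sum,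
    Finset.smul_sum, ← Finset.sum_add_distrib]
  exact add_le_add hE (Finset.sum_le_sum fun i _ =>
    (hB i).2 (Set.mem_univ _) (Set.mem_univ _) ha.le hb.le hab)

theorem lowerSemicontinuous_perturbedEnergy [ProperSpace E]
    (hp : ∀ i j, i ≠ j → ‖p i - p j‖ = 1) (hN : 0 < N) (hB : ∀ i, LowerSemicontinuous (B i)) :
    LowerSemicontinuous (perturbedEnergy p μ B) := by
  refine lowerSemicontinuous_iff_isClosed_preimage.2 fun c => ?_
  rcases eq_or_ne c ⊤ with rfl | hc
  · simp only [Set.Iic_top, Set.preimage_univ, isClosed_univ]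
  refine IsSeqClosed.isClosed fun u v (hu : ∀ n, perturbedEnergy p μ B (u n) ≤ c) huv => ?_
  choose g hg hug using fun n => exists_of_perturbedEnergy_ne_top (ne_top_of_le_ne_top hc (hu n))
  have total_le (n : ℕ) : energy p (g n) + ∑ i, B i (g n (vertex p i)) ≤ c :=
    perturbedEnergy_eq p μ B (u n) (g n) (hg n) (hug n) ▸ hu n
  have level_le (n : ℕ) : ∀ m, levelEnergy p m (g n) ≤ c.toReal := by
    rw [← energy_le_ofReal_iff hp hN ENNReal.toReal_nonneg, ENNReal.ofReal_toReal hc]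
    exact le_self_add.trans (total_le n)
  obtain ⟨φ, -, hae⟩ := (tendstoInMeasure_of_tendsto_Lp huv).exists_seq_tendsto_ae
  have ae_tendsto : ∀ᵐ x ∂μ, Tendsto (fun n => g (φ n) x) atTop (𝓝 (v x)) := by
    filter_upwards [hae, ae_all_iff.2 hug] with x hx hgx
    exact hx.congr fun n => hgx (φ n)
  obtain ⟨f, hf, hgf⟩ := exists_continuous_limit_of_equicontinuous
    (equicontinuous_of_levelEnergy_le hp hN fun n => level_le (φ n))
    (Measure.dense_of_ae ae_tendsto) fun x hx => Tendsto.cauchySeq hx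
  have hvf : v =ᵐ[μ] f := by
    filter_upwards [ae_tendsto] with x hx using tendsto_nhds_unique hx (tendsto_pi_nhds.1 hgf x)
  have lsc : LowerSemicontinuous fun k : gasket p → ℝ => energy p k + ∑ i, B i (k (vertex p i)) :=
    (lowerSemicontinuous_energy hp hN).add
      (lowerSemicontinuous_sum fun i _ => (hB i).comp (continuous_apply _))
  have limit_le : energy p f + ∑ i, B i (f (vertex p i)) ≤ c :=
    (lsc.isClosed_preimage c).mem_of_tendsto hgf (Eventually.of_forall fun n => total_le (φ n))
  change perturbedEnergy p μ B v ≤ c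
  rwa [perturbedEnergy_eq p μ B v ⟨f, hf⟩ ((le_self_add.trans limit_le).trans_lt hc.lt_top) hvf]

end Perturbed

section HarmonicExtension

variable {E : Type*} [NormedAddCommGroup E] [InnerProductSpace ℝ E] {N : ℕ} {p : Fin N → E}

theorem harmonicStep_mem {s : Set ℝ} (hs : Convex ℝ s) {c : Fin N → ℝ} (hc : ∀ j, c j ∈ s)
    (i j : Fin N) : harmonicStep c i j ∈ s := by
  rcases eq_or_ne i j with rfl | hij
  · exact harmonicStep_self c i ▸ hc i
  have eq_sum : harmonicStep c i j =
      ∑ k, (((if k = i then 1 else 0) + (if k = j then 1 else 0) + 1) / ((N : ℝ) + 2)) • c k := by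
    simp only [harmonicStep_of_ne c hij, smul_eq_mul, div_mul_eq_mul_div, add_mul, ite_mul, one_mul,
      zero_mul, ← Finset.sum_div, Finset.sum_add_distrib, Finset.sum_ite_eq', Finset.mem_univ,
      if_true]
  rw [eq_sum]
  refine hs.sum_mem (fun k _ => by positivity) ?_ fun k _ => hc k
  simp only [← Finset.sum_div, Finset.sum_add_distrib, Finset.sum_ite_eq', Finset.mem_univ, if_true,
    Finset.sum_const, Finset.card_univ, Fintype.card_fin, nsmul_eq_mul, mul_one]
  field_simp
  ring

theorem abs_harmonicStep_sub_self_le {c : Fin N → ℝ} {d : ℝ} (hc : ∀ j k, |c j - c k| ≤ d)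
    {i j : Fin N} (hij : i ≠ j) : |harmonicStep c i j - c i| ≤ N / (N + 2) * d := by
  have eq_div : harmonicStep c i j - c i = ((c j - c i) + ∑ l, (c l - c i)) / (N + 2) := by
    rw [harmonicStep_of_ne c hij, Finset.sum_sub_distrib, Finset.sum_const, Finset.card_univ,
      Fintype.card_fin, nsmul_eq_mul]
    field_simp
    ring
  have sum_le : |∑ l, (c l - c i)| ≤ (N - 1) * d := by
    rw [← Finset.sum_erase Finset.univ (a := i) (f := fun l => c l - c i) (sub_self _)]
    refine (Finset.abs_sum_le_sum_abs _ _).trans ((Finset.sum_le_card_nsmul _ _ d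
      fun l _ => hc l i).trans_eq ?_)
    rw [Finset.card_erase_of_mem (Finset.mem_univ i), Finset.card_univ, Fintype.card_fin,
      nsmul_eq_mul, Nat.cast_pred i.pos]
  rw [eq_div, abs_div, abs_of_pos (by positivity : (0 : ℝ) < N + 2), div_mul_eq_mul_div]
  gcongr
  linarith [abs_add_le (c j - c i) (∑ l, (c l - c i)), hc j i]

theorem abs_harmonicStep_sub_le {c : Fin N → ℝ} {d : ℝ} (hc : ∀ j k, |c j - c k| ≤ d)
    (i j k : Fin N) : |harmonicStep c i j - harmonicStep c i k| ≤ N / (N + 2) * d := by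
  have hd : 0 ≤ d := (abs_nonneg _).trans (hc i i)
  rcases eq_or_ne i j with rfl | hj <;> rcases eq_or_ne i k with rfl | hk
  · rw [sub_self, abs_zero]; positivity
  · rw [harmonicStep_self, abs_sub_comm]; exact abs_harmonicStep_sub_self_le hc hk
  · rw [harmonicStep_self]; exact abs_harmonicStep_sub_self_le hc hj
  · have eq_div : harmonicStep c i j - harmonicStep c i k = (c j - c k) / (N + 2) := by
      rw [harmonicStep_of_ne c hj, harmonicStep_of_ne c hk]; ring
    have one_le : (1 : ℝ) ≤ N := by exact_mod_cast i.pos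
    rw [eq_div, abs_div, abs_of_pos (by positivity : (0 : ℝ) < N + 2), div_mul_eq_mul_div]
    gcongr
    exact (hc j k).trans (le_mul_of_one_le_left hd one_le)

theorem sum_bary (hp : ∀ i j, i ≠ j → ‖p i - p j‖ = 1) {x : E} (hx : x ∈ gasket p) :
    ∑ i, bary p i x = 1 := by
  have sum_bary_vertex (j : Fin N) : ∑ i, bary p i (p j) = 1 := by
    rw [Finset.sum_eq_single_of_mem j (Finset.mem_univ j) fun i _ hij => bary_of_ne hp hij,
      bary_self]
  have closed : IsClosed {x | ∑ i, bary p i x = 1} :=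
    isClosed_eq (continuous_finsetSum _ fun i _ => continuous_bary i) continuous_const
  refine gasket_subset_of_isClosed closed sum_bary_vertex (fun j x hx => ?_) hx
  have hx : ∑ i, bary p i x = 1 := hx
  change ∑ i, bary p i (similarity p j x) = 1
  simp only [bary_similarity, Finset.sum_add_distrib, ← Finset.mul_sum, hx, sum_bary_vertex]
  norm_num

/-- An operator extending boundary values to continuous functions on the gasket and satisfying the
maximum principle, in the form that closed convex sets of boundary values are preserved. -/
structure IsMeanExtension (h : (Fin N → ℝ) → C(gasket p, ℝ)) : Prop where
  apply_vertex : ∀ c j, h c (vertex p j) = c j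
  mem_of_convex : ∀ ⦃s : Set ℝ⦄, IsClosed s → Convex ℝ s → ∀ ⦃c : Fin N → ℝ⦄, (∀ j, c j ∈ s) →
    ∀ x, h c x ∈ s

/-- The function on the gasket that is affine in the barycentric coordinates with values `c` at the
vertices. -/
def baryExtension (p : Fin N → E) (c : Fin N → ℝ) : C(gasket p, ℝ) where
  toFun x := ∑ j, bary p j x * c j
  continuous_toFun := continuous_finsetSum _ fun j _ =>
    ((continuous_bary j).comp continuous_subtype_val).mul continuous_const

theorem isMeanExtension_baryExtension (hp : ∀ i j, i ≠ j → ‖p i - p j‖ = 1) :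
    IsMeanExtension (baryExtension p) where
  apply_vertex c j := by
    change ∑ k, bary p k (p j) * c k = c j
    rw [Finset.sum_eq_single_of_mem j (Finset.mem_univ j) fun k _ hk => by
      rw [bary_of_ne hp hk, zero_mul], bary_self, one_mul]
  mem_of_convex _ _ hs _ hc x :=
    hs.sum_mem (fun i _ => (bary_nonneg_and_norm_sub_le hp i x.2).1) (sum_bary hp x.2)
      fun j _ => hc j

theorem exists_glue [ProperSpace E] (hp : ∀ i j, i ≠ j → ‖p i - p j‖ = 1)
    (g : Fin N → C(gasket p, ℝ)) (hg : ∀ i j, g i (vertex p j) = g j (vertex p i)) :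
    ∃ G : C(gasket p, ℝ), ∀ i x, G (cellMap p i x) = g i x := by
  have compatible {i j : Fin N} {x y : gasket p} (h : cellMap p i x = cellMap p j y) :
      g i x = g j y := by
    rcases eq_or_ne i j with rfl | hij
    · rw [cellMap_injective i h]
    · rw [eq_vertex_of_cellMap_eq hp hij h, eq_vertex_of_cellMap_eq hp hij.symm h.symm, hg]
  choose idx pt cellMap_pt using exists_cellMap_eq (p := p)
  set G : gasket p → ℝ := fun x => g (idx x) (pt x)
  have G_cellMap (i : Fin N) (x : gasket p) : G (cellMap p i x) = g i x :=
    compatible (cellMap_pt _)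
  refine ⟨⟨G, continuous_iff_isClosed.2 fun T hT => ?_⟩, G_cellMap⟩
  have preimage_eq : G ⁻¹' T = ⋃ i, cellMap p i '' (g i ⁻¹' T) := by
    ext x
    simp only [Set.mem_preimage, Set.mem_iUnion, Set.mem_image]
    constructor
    · exact fun hx => ⟨idx x, pt x, hx, cellMap_pt x⟩
    · rintro ⟨i, y, hy, rfl⟩
      rwa [G_cellMap]
  rw [preimage_eq]
  exact isClosed_iUnion_of_finite fun i =>
    ((hT.preimage (g i).continuous).isCompact.image (continuous_cellMap i)).isClosed

theorem IsMeanExtension.exists_refinement [ProperSpace E] (hp : ∀ i j, i ≠ j → ‖p i - p j‖ = 1)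
    {h : (Fin N → ℝ) → C(gasket p, ℝ)} (hh : IsMeanExtension h) :
    ∃ k : (Fin N → ℝ) → C(gasket p, ℝ), IsMeanExtension k ∧
      ∀ c i x, k c (cellMap p i x) = h (harmonicStep c i) x := by
  choose k hk using fun c => exists_glue hp (fun i => h (harmonicStep c i)) fun i j => by
    rw [hh.apply_vertex, hh.apply_vertex, harmonicStep_comm]
  refine ⟨k, ⟨fun c j => ?_, fun s hs hconv c hc x => ?_⟩, hk⟩
  · rw [← cellMap_vertex j, hk, hh.apply_vertex, harmonicStep_self]
  · obtain ⟨i, y, rfl⟩ := exists_cellMap_eq x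
    rw [hk]
    exact hh.mem_of_convex hs hconv (harmonicStep_mem hconv hc i) y

theorem exists_refinement_sequence [ProperSpace E] (hp : ∀ i j, i ≠ j → ‖p i - p j‖ = 1) :
    ∃ h : ℕ → (Fin N → ℝ) → C(gasket p, ℝ), (∀ n, IsMeanExtension (h n)) ∧
      ∀ n c i x, h (n + 1) c (cellMap p i x) = h n (harmonicStep c i) x := by
  choose T hT using fun k : {k : (Fin N → ℝ) → C(gasket p, ℝ) // IsMeanExtension k} =>
    k.2.exists_refinement hp
  let h (n : ℕ) := (fun k => (⟨T k, (hT k).1⟩ : {k // IsMeanExtension k}))^[n]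
    ⟨baryExtension p, isMeanExtension_baryExtension hp⟩
  refine ⟨fun n => (h n).1, fun n => (h n).2, fun n c i x => ?_⟩
  simp only [h, Function.iterate_succ_apply']
  exact (hT _).2 c i x

theorem abs_refinement_sub_le [ProperSpace E] {h : ℕ → (Fin N → ℝ) → C(gasket p, ℝ)}
    (hh : ∀ n, IsMeanExtension (h n))
    (hs : ∀ n c i x, h (n + 1) c (cellMap p i x) = h n (harmonicStep c i) x) (n : ℕ)
    {c : Fin N → ℝ} {d : ℝ} (hc : ∀ j k, |c j - c k| ≤ d) (x : gasket p) :
    |h (n + 1) c x - h n c x| ≤ 2 * d * (N / (N + 2)) ^ n := by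
  induction n generalizing c d x with
  | zero =>
    obtain ⟨i, -⟩ := exists_cellMap_eq x
    have mem_ball (n : ℕ) : |h n c x - c i| ≤ d :=
      (hh n).mem_of_convex Metric.isClosed_closedBall (convex_closedBall (c i) d)
        (fun j => hc j i) x
    have := abs_sub_le (h 1 c x) (c i) (h 0 c x)
    rw [abs_sub_comm (c i)] at this
    linarith [mem_ball 0, mem_ball 1]
  | succ n ih =>
    obtain ⟨i, y, rfl⟩ := exists_cellMap_eq x
    rw [hs, hs]
    exact (ih (abs_harmonicStep_sub_le hc i) y).trans_eq (by ring)

theorem cauchySeq_refinement [ProperSpace E] {h : ℕ → (Fin N → ℝ) → C(gasket p, ℝ)}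
    (hh : ∀ n, IsMeanExtension (h n))
    (hs : ∀ n c i x, h (n + 1) c (cellMap p i x) = h n (harmonicStep c i) x) (c : Fin N → ℝ) :
    CauchySeq fun n => h n c := by
  obtain ⟨d, hd⟩ := Metric.isBounded_iff.1 (Set.finite_range c).isBounded
  have hc (j k : Fin N) : |c j - c k| ≤ max d 0 :=
    (hd (Set.mem_range_self j) (Set.mem_range_self k)).trans (le_max_left d 0)
  refine cauchySeq_of_le_geometric (N / (N + 2) : ℝ) (2 * max d 0)
    (by rw [div_lt_one (by positivity)]; linarith) fun n => ?_
  refine (ContinuousMap.dist_le (by positivity)).2 fun x => ?_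
  rw [dist_comm, Real.dist_eq]
  exact abs_refinement_sub_le hh hs n hc x

theorem exists_harmonic [ProperSpace E] (hp : ∀ i j, i ≠ j → ‖p i - p j‖ = 1) :
    ∃ h : (Fin N → ℝ) → C(gasket p, ℝ), IsMeanExtension h ∧
      ∀ c i x, h c (cellMap p i x) = h (harmonicStep c i) x := by
  obtain ⟨h, hh, hs⟩ := exists_refinement_sequence hp
  choose H hH using fun c => cauchySeq_tendsto_of_complete (cauchySeq_refinement hh hs c)
  have tendsto_apply (c : Fin N → ℝ) (x : gasket p) :
      Tendsto (fun n => h n c x) atTop (𝓝 (H c x)) :=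
    ((continuous_eval_const x).tendsto (H c)).comp (hH c)
  refine ⟨H, ⟨fun c j => tendsto_nhds_unique (tendsto_apply c _) ?_, fun s hs hconv c hc x => ?_⟩,
    fun c i x => ?_⟩
  · simp only [(hh _).apply_vertex, tendsto_const_nhds]
  · exact hs.mem_of_tendsto (tendsto_apply c x)
      (Eventually.of_forall fun n => (hh n).mem_of_convex hs hconv hc x)
  · refine tendsto_nhds_unique ((tendsto_add_atTop_iff_nat 1).2 (tendsto_apply c _)) ?_
    simp only [hs, tendsto_apply]

theorem levelEnergy_harmonic (hp : ∀ i j, i ≠ j → ‖p i - p j‖ = 1) (hN : 0 < N)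
    {h : (Fin N → ℝ) → C(gasket p, ℝ)} (hv : ∀ c j, h c (vertex p j) = c j)
    (hs : ∀ c i x, h c (cellMap p i x) = h (harmonicStep c i) x) (m : ℕ) (c : Fin N → ℝ) :
    levelEnergy p m (h c) = 1 / 2 * ∑ i, ∑ j, (c i - c j) ^ 2 := by
  induction m generalizing c with
  | zero => simp only [levelEnergy_zero hp, hv]
  | succ m ih =>
    rw [levelEnergy_succ hp]
    simp only [hs, ih]
    rw [sum_sub_sq_eq_harmonicStep hN, ← Finset.mul_sum]
    ring

end HarmonicExtension

section Splines

variable {E : Type*} [NormedAddCommGroup E] [InnerProductSpace ℝ E] {N : ℕ} {p : Fin N → E}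

theorem mem_H1_iff (hp : ∀ i j, i ≠ j → ‖p i - p j‖ = 1) (hN : 0 < N) {g : C(gasket p, ℝ)} :
    g ∈ H1 p ↔ ∃ C, ∀ m, levelEnergy p m g ≤ C := by
  constructor
  · intro hg
    refine ⟨(energy p g).toReal, (energy_le_ofReal_iff hp hN ENNReal.toReal_nonneg).1 ?_⟩
    rw [ENNReal.ofReal_toReal hg.ne]
  · rintro ⟨C, hC⟩
    have hC0 : 0 ≤ C := (levelEnergy_nonneg 0 _).trans (hC 0)
    exact ((energy_le_ofReal_iff hp hN hC0).2 hC).trans_lt ENNReal.ofReal_lt_top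

theorem mem_H1_of_comp_cellMap (hp : ∀ i j, i ≠ j → ‖p i - p j‖ = 1) (hN : 0 < N)
    {G : C(gasket p, ℝ)} {g : Fin N → C(gasket p, ℝ)} (hG : ∀ i x, G (cellMap p i x) = g i x)
    (hg : ∀ i, g i ∈ H1 p) : G ∈ H1 p := by
  choose C hC using fun i => (mem_H1_iff hp hN).1 (hg i)
  refine (mem_H1_iff hp hN).2 ⟨((N : ℝ) + 2) / N * ∑ i, C i, fun m => ?_⟩
  refine (monotone_levelEnergy hp hN G m.le_succ).trans ?_
  simp only [Nat.succ_eq_add_one, levelEnergy_succ hp, hG]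
  gcongr with i
  exact hC i m

theorem exists_spline [ProperSpace E] (hp : ∀ i j, i ≠ j → ‖p i - p j‖ = 1) (hN : 0 < N) (m : ℕ)
    {d : ℝ} (f : C(gasket p, ℝ)) (hf : ∀ w, w.length = m → ∀ j k,
      |f (cellWord p w (vertex p j)) - f (cellWord p w (vertex p k))| ≤ d) :
    ∃ g ∈ H1 p, (∀ j, g (vertex p j) = f (vertex p j)) ∧ ∀ w, w.length = m → ∀ j x,
      |g (cellWord p w x) - f (cellWord p w (vertex p j))| ≤ d := by
  induction m generalizing f with
  | zero =>
    obtain ⟨h, hh, hs⟩ := exists_harmonic hp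
    refine ⟨h fun j => f (vertex p j),
      (mem_H1_iff hp hN).2 ⟨_, fun m => (levelEnergy_harmonic hp hN hh.apply_vertex hs m _).le⟩,
      hh.apply_vertex _, fun w hw j x => ?_⟩
    rw [List.length_eq_zero_iff.1 hw]
    exact hh.mem_of_convex Metric.isClosed_closedBall (convex_closedBall (f (vertex p j)) d)
      (fun k => hf [] rfl k j) x
  | succ m ih =>
    choose g hgH hgv hgw using fun i => ih (f.comp ⟨cellMap p i, continuous_cellMap i⟩)
      fun w hw j k => hf (i :: w) (by rw [List.length_cons, hw]) j k
    obtain ⟨G, hG⟩ := exists_glue hp g fun i j => by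
      rw [hgv, hgv]
      exact congrArg f (cellMap_vertex_comm i j)
    refine ⟨G, mem_H1_of_comp_cellMap hp hN hG hgH, fun j => ?_, fun w hw j x => ?_⟩
    · rw [← cellMap_vertex j, hG, hgv]
      rfl
    · obtain ⟨i, v, rfl⟩ := List.exists_cons_of_length_eq_add_one hw
      simp only [cellWord, Function.comp_apply, hG]
      exact hgw i v (Nat.succ_injective hw) j x

theorem exists_abs_sub_cellWord_le [ProperSpace E] (f : C(gasket p, ℝ)) {ε : ℝ} (hε : 0 < ε) :
    ∃ m, ∀ w, w.length = m → ∀ x y, |f (cellWord p w x) - f (cellWord p w y)| ≤ ε := by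
  obtain ⟨δ, hδ, hf⟩ := Metric.uniformContinuous_iff.1
    (CompactSpace.uniformContinuous_of_continuous f.continuous) ε hε
  obtain ⟨D, hD⟩ := Metric.isBounded_iff.1 (isCompact_univ (X := gasket p)).isBounded
  have shrink : Tendsto (fun m : ℕ => (1 / 2 : ℝ) ^ m * D) atTop (𝓝 0) := by
    simpa using (tendsto_pow_atTop_nhds_zero_of_lt_one (r := (1 / 2 : ℝ)) (by norm_num)
      (by norm_num)).mul_const D
  obtain ⟨m, hm⟩ := (shrink.eventually_lt_const hδ).exists
  refine ⟨m, fun w hw x y => (hf ?_).le⟩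
  rw [dist_cellWord, hw]
  exact (mul_le_mul_of_nonneg_left (hD (Set.mem_univ x) (Set.mem_univ y)) (by positivity)).trans_lt
    hm

theorem mem_closure_H1 [ProperSpace E] (hp : ∀ i j, i ≠ j → ‖p i - p j‖ = 1) (hN : 0 < N)
    (f : C(gasket p, ℝ)) :
    f ∈ closure {g | g ∈ H1 p ∧ ∀ j, g (vertex p j) = f (vertex p j)} := by
  refine Metric.mem_closure_iff.2 fun ε hε => ?_
  obtain ⟨m, hm⟩ := exists_abs_sub_cellWord_le f (ε := ε / 3) (by positivity)
  obtain ⟨g, hgH, hgv, hgw⟩ := exists_spline hp hN m f fun w hw j k => hm w hw _ _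
  refine ⟨g, ⟨hgH, hgv⟩, lt_of_le_of_lt ?_ (by linarith : ε / 3 + ε / 3 < ε)⟩
  refine (ContinuousMap.dist_le (by positivity)).2 fun x => ?_
  obtain ⟨w, y, hw, rfl⟩ := exists_cellWord_eq m x
  have j : Fin N := ⟨0, hN⟩
  refine (dist_triangle_right _ _ (f (cellWord p w (vertex p j)))).trans (add_le_add ?_ ?_)
  · exact hm w hw _ _
  · exact hgw w hw j y

end Splines

section Density

theorem tendsto_toLp_of_tendsto_ae {X : Type*} [TopologicalSpace X] [CompactSpace X]
    [MeasurableSpace X] [BorelSpace X] {μ : Measure X} [IsFiniteMeasure μ] {f : ℕ → C(X, ℝ)}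
    {g : C(X, ℝ)} {M : ℝ} (hM : ∀ n, ‖f n‖ ≤ M)
    (hfg : ∀ᵐ x ∂μ, Tendsto (fun n => f n x) atTop (𝓝 (g x))) :
    Tendsto (fun n => ContinuousMap.toLp 2 μ ℝ (f n)) atTop (𝓝 (ContinuousMap.toLp 2 μ ℝ g)) := by
  have integral_tendsto :
      Tendsto (fun n => ∫ x, ((f n - g) x) ^ 2 ∂μ) atTop (𝓝 (∫ _, (0 : ℝ) ∂μ)) := by
    refine tendsto_integral_of_dominated_convergence (fun _ => (M + ‖g‖) ^ 2)
      (fun n => ((f n - g).continuous.pow 2).aestronglyMeasurable) (integrable_const _)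
      (fun n => Eventually.of_forall fun x => ?_) ?_
    · rw [norm_pow]
      gcongr
      exact ((f n - g).norm_coe_le_norm x).trans
        ((norm_sub_le _ _).trans (add_le_add_left (hM n) _))
    · filter_upwards [hfg] with x hx
      simpa using (hx.sub_const (g x)).pow 2
  have norm_sq_eq (n : ℕ) : ∫ x, ((f n - g) x) ^ 2 ∂μ =
      ‖ContinuousMap.toLp 2 μ ℝ (f n) - ContinuousMap.toLp 2 μ ℝ g‖ ^ 2 := by
    rw [← map_sub, norm_sq_eq_integral]
    refine integral_congr_ae ?_
    filter_upwards [ContinuousMap.coeFn_toLp (p := 2) (𝕜 := ℝ) μ (f n - g)] with x hx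
    rw [hx]
  simp only [integral_zero, norm_sq_eq] at integral_tendsto
  refine tendsto_iff_norm_sub_tendsto_zero.2 ?_
  simpa only [Real.sqrt_sq (norm_nonneg _), Real.sqrt_zero] using integral_tendsto.sqrt

/-- Continuous functions with values in `[0, 1]` that vanish on the closed set `s` and increase to
`1` off it. -/
def cutoff {X : Type*} [PseudoMetricSpace X] (s : Set X) (n : ℕ) : C(X, ℝ) where
  toFun x := min 1 (n * Metric.infDist x s)
  continuous_toFun := continuous_const.min (continuous_const.mul (Metric.continuous_infDist_pt s))

theorem cutoff_of_mem {X : Type*} [PseudoMetricSpace X] {s : Set X} (n : ℕ) {x : X} (hx : x ∈ s) :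
    cutoff s n x = 0 := by
  simp [cutoff, Metric.infDist_zero_of_mem hx]

theorem abs_cutoff_le_one {X : Type*} [PseudoMetricSpace X] (s : Set X) (n : ℕ) (x : X) :
    |cutoff s n x| ≤ 1 := by
  have nonneg : 0 ≤ cutoff s n x :=
    le_min zero_le_one (mul_nonneg n.cast_nonneg Metric.infDist_nonneg)
  rw [abs_of_nonneg nonneg]
  exact min_le_left _ _

theorem tendsto_cutoff {X : Type*} [PseudoMetricSpace X] {s : Set X} (hs : IsClosed s)
    (hne : s.Nonempty) {x : X} (hx : x ∉ s) : Tendsto (fun n => cutoff s n x) atTop (𝓝 1) := by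
  have infDist_pos := (hs.notMem_iff_infDist_pos hne).1 hx
  refine tendsto_const_nhds.congr' ?_
  filter_upwards [((tendsto_natCast_atTop_atTop (R := ℝ)).atTop_mul_const
    infDist_pos).eventually_ge_atTop 1] with n hn
  exact (min_eq_left hn).symm

variable {E : Type*} [NormedAddCommGroup E] [InnerProductSpace ℝ E] [ProperSpace E]
  [MeasurableSpace E] [BorelSpace E] {N : ℕ} {p : Fin N → E} {μ : Measure (gasket p)}
  [IsFiniteMeasure μ] [μ.IsOpenPosMeasure]

theorem toLp_mem_closure_perturbedEnergy_ne_top (hp : ∀ i j, i ≠ j → ‖p i - p j‖ = 1) (hN : 0 < N)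
    {B : Fin N → ℝ → ℝ≥0∞} (hB : ∀ i, B i 0 = 0) {f : C(gasket p, ℝ)}
    (hf : ∀ i, f (vertex p i) = 0) :
    ContinuousMap.toLp 2 μ ℝ f ∈ closure {u : Lp ℝ 2 μ | perturbedEnergy p μ B u ≠ ⊤} := by
  refine map_mem_closure (ContinuousMap.toLp 2 μ ℝ).continuous (mem_closure_H1 hp hN f) ?_
  rintro g ⟨hgH, hgv⟩
  change perturbedEnergy p μ B _ ≠ ⊤
  rw [perturbedEnergy_eq p μ B _ g hgH (ContinuousMap.coeFn_toLp μ g)]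
  simpa only [hgv, hf, hB, Finset.sum_const_zero, add_zero] using hgH.ne

theorem dense_perturbedEnergy_ne_top (hp : ∀ i j, i ≠ j → ‖p i - p j‖ = 1) (hN : 0 < N)
    (hμ : μ (boundary p) = 0) {B : Fin N → ℝ → ℝ≥0∞} (hB : ∀ i, B i 0 = 0) :
    Dense {u : Lp ℝ 2 μ | perturbedEnergy p μ B u ≠ ⊤} := by
  refine fun u => closure_minimal ?_ isClosed_closure
    (ContinuousMap.toLp_denseRange (p := 2) ℝ μ ℝ (by norm_num) u)
  rintro _ ⟨f, rfl⟩
  have tendsto_toLp : Tendsto (fun n => ContinuousMap.toLp 2 μ ℝ (f * cutoff (boundary p) n)) atTop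
      (𝓝 (ContinuousMap.toLp 2 μ ℝ f)) := by
    refine tendsto_toLp_of_tendsto_ae (M := ‖f‖) (fun n => ?_) ?_
    · refine (norm_mul_le _ _).trans (mul_le_of_le_one_right (norm_nonneg _) ?_)
      exact (ContinuousMap.norm_le _ zero_le_one).2 (abs_cutoff_le_one _ n)
    · filter_upwards [compl_mem_ae_iff.2 hμ] with x hx
      have tendsto_one := tendsto_cutoff (s := boundary p) (Set.finite_range _).isClosed
        ⟨vertex p ⟨0, hN⟩, Set.mem_range_self _⟩ hx
      simpa using tendsto_one.const_mul (f x)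
  refine isClosed_closure.mem_of_tendsto tendsto_toLp (Eventually.of_forall fun n =>
    toLp_mem_closure_perturbedEnergy_ne_top hp hN hB fun i => ?_)
  rw [ContinuousMap.mul_apply, cutoff_of_mem (s := boundary p) n (Set.mem_range_self i), mul_zero]

end Density

section Boundary

theorem BiMonotone.truncationDominated {f : ℝ → ℝ≥0∞} (hf : BiMonotone f) :
    TruncationDominated f fun _ => 0 := fun s t ht => by
  suffices h : f ((s ⊓ t) ⊔ -t) ≤ f s by simpa only [add_zero] using h
  have hneg : -t ≤ 0 := neg_nonpos.2 ht
  rcases le_total 0 s with hs | hs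
  · rw [sup_eq_left.2 (hneg.trans (le_inf hs ht))]
    exact hf.2 (le_inf hs ht) hs inf_le_left
  · rw [inf_eq_left.2 (hs.trans ht)]
    exact hf.1 hs (sup_le hs hneg) le_sup_left

open Classical in
/-- The convex indicator function of `{0}`, the boundary term of the Dirichlet energy. -/
def zeroIndicator (s : ℝ) : ℝ≥0∞ := if s = 0 then 0 else ⊤

theorem zeroIndicator_zero : zeroIndicator 0 = 0 := if_pos rfl

theorem zeroIndicator_of_ne {s : ℝ} (hs : s ≠ 0) : zeroIndicator s = ⊤ := if_neg hs

theorem lowerSemicontinuous_zeroIndicator : LowerSemicontinuous zeroIndicator := fun s c hc => by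
  rcases eq_or_ne s 0 with rfl | hs
  · exact absurd (hc.trans_eq zeroIndicator_zero) not_lt_zero
  · filter_upwards [isOpen_ne.mem_nhds hs] with t ht
    rwa [zeroIndicator_of_ne ht, ← zeroIndicator_of_ne hs]

theorem convexOn_zeroIndicator : ConvexOn ℝ≥0 Set.univ zeroIndicator := by
  refine convexOn_iff_forall_pos.2 ⟨convex_univ, fun s _ t _ a b ha hb _ => ?_⟩
  rcases eq_or_ne s 0 with rfl | hs
  · rcases eq_or_ne t 0 with rfl | ht
    · simp only [smul_zero, add_zero, zeroIndicator_zero, le_refl]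
    · rw [zeroIndicator_of_ne ht, ENNReal.smul_top, if_neg hb.ne', add_top]; exact le_top
  · rw [zeroIndicator_of_ne hs, ENNReal.smul_top, if_neg ha.ne', top_add]; exact le_top

theorem truncationDominated_zeroIndicator (f : ℝ → ℝ≥0∞) :
    TruncationDominated zeroIndicator f := fun s t ht => by
  rcases eq_or_ne s 0 with rfl | hs
  · rw [inf_eq_left.2 ht, sup_eq_left.2 (neg_nonpos.2 ht), abs_zero, sup_eq_right.2 ht]
  · rw [zeroIndicator_of_ne hs, top_add]; exact le_top

end Boundary

section Semigroups

variable {E : Type*} [NormedAddCommGroup E] [InnerProductSpace ℝ E] [MeasurableSpace E] {N : ℕ}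
  {p : Fin N → E} {μ : Measure (gasket p)} [μ.IsOpenPosMeasure]

theorem totallyDominatedBy_flow_perturbedEnergy (hp : ∀ i j, i ≠ j → ‖p i - p j‖ = 1)
    (hN : 0 < N) {B₁ B₂ : Fin N → ℝ → ℝ≥0∞} (h₁ : IsConvexEnergy (perturbedEnergy p μ B₁))
    (h₂ : IsConvexEnergy (perturbedEnergy p μ B₂)) (h0 : ∀ i, B₂ i 0 = 0)
    (hdom : ∀ i, TruncationDominated (B₁ i) (B₂ i))
    (hdom_neg : ∀ i, TruncationDominated (B₁ i) fun s => B₂ i (-s)) :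
    TotallyDominatedBy (flow (perturbedEnergy p μ B₁)) (flow (perturbedEnergy p μ B₂)) := by
  refine h₁.totallyDominatedBy_flow h₂ (perturbedEnergy_zero h0)
    (isSubmodular_perturbedEnergy hp hN B₂) (truncationDominated_perturbedEnergy hp hN hdom) ?_
  rw [perturbedEnergy_comp_neg]
  exact truncationDominated_perturbedEnergy hp hN hdom_neg

variable [ProperSpace E] [BorelSpace E] [IsFiniteMeasure μ]

theorem isConvexEnergy_perturbedEnergy (hp : ∀ i j, i ≠ j → ‖p i - p j‖ = 1) (hN : 0 < N)
    (hμ : μ (boundary p) = 0) {B : Fin N → ℝ → ℝ≥0∞} (hlsc : ∀ i, LowerSemicontinuous (B i))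
    (hB : ∀ i, B i 0 = 0) (hconv : ConvexOn ℝ≥0 Set.univ (perturbedEnergy p μ B)) :
    IsConvexEnergy (perturbedEnergy p μ B) :=
  ⟨hconv, lowerSemicontinuous_perturbedEnergy hp hN hlsc, dense_perturbedEnergy_ne_top hp hN hμ hB⟩

theorem isConvexEnergy_neumannEnergy (hp : ∀ i j, i ≠ j → ‖p i - p j‖ = 1) (hN : 0 < N)
    (hμ : μ (boundary p) = 0) : IsConvexEnergy (neumannEnergy p μ) :=
  isConvexEnergy_perturbedEnergy hp hN hμ (fun _ => lowerSemicontinuous_const) (fun _ => rfl)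
    (convexOn_perturbedEnergy hp hN fun _ => convexOn_const 0 convex_univ)

theorem isConvexEnergy_dirichletEnergy (hp : ∀ i j, i ≠ j → ‖p i - p j‖ = 1) (hN : 0 < N)
    (hμ : μ (boundary p) = 0) : IsConvexEnergy (dirichletEnergy p μ) :=
  isConvexEnergy_perturbedEnergy hp hN hμ (B := fun _ => zeroIndicator)
    (fun _ => lowerSemicontinuous_zeroIndicator) (fun _ => zeroIndicator_zero)
    (convexOn_perturbedEnergy hp hN fun _ => convexOn_zeroIndicator)

theorem corollary4p1_general (hN : 0 < N) (hp : ∀ i j, i ≠ j → ‖p i - p j‖ = 1)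
    (hμ : μ (boundary p) = 0) {B : Fin N → ℝ → ℝ≥0∞} (hlsc : ∀ i, LowerSemicontinuous (B i))
    (hmono : ∀ i, BiMonotone (B i)) (hnorm : ∀ i, B i 0 = 0)
    (hconv : ConvexOn ℝ≥0 Set.univ (perturbedEnergy p μ B)) :
    (∃! S, Generates (perturbedEnergy p μ B) S) ∧ (∃! S, Generates (neumannEnergy p μ) S) ∧
    (∃! S, Generates (dirichletEnergy p μ) S) ∧
    ∀ S_B S S_inf : ContractionSemigroup (Lp ℝ 2 μ), Generates (perturbedEnergy p μ B) S_B →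
      Generates (neumannEnergy p μ) S → Generates (dirichletEnergy p μ) S_inf →
      IsPositive S_B ∧ OrderPreserving S_B ∧
      TotallyDominatedBy S_inf S_B ∧ TotallyDominatedBy S_B S := by
  have perturbed := isConvexEnergy_perturbedEnergy hp hN hμ hlsc hnorm hconv
  have neumann := isConvexEnergy_neumannEnergy hp hN hμ
  have dirichlet := isConvexEnergy_dirichletEnergy hp hN hμ
  refine ⟨perturbed.existsUnique_generates, neumann.existsUnique_generates,
    dirichlet.existsUnique_generates, fun S_B S S_inf hS_B hS hS_inf => ?_⟩
  rw [hS_B.toFun_eq_flow perturbed, hS.toFun_eq_flow neumann, hS_inf.toFun_eq_flow dirichlet]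
  have submodular := isSubmodular_perturbedEnergy (μ := μ) hp hN B
  refine ⟨perturbed.isPositive_flow (perturbedEnergy_zero hnorm) submodular,
    perturbed.orderPreserving_flow submodular, ?_, ?_⟩
  · exact totallyDominatedBy_flow_perturbedEnergy hp hN dirichlet perturbed hnorm
      (fun _ => truncationDominated_zeroIndicator _) fun _ => truncationDominated_zeroIndicator _
  · exact totallyDominatedBy_flow_perturbedEnergy hp hN perturbed neumann (fun _ => rfl)
      (fun i => (hmono i).truncationDominated) fun i => (hmono i).truncationDominated

end Semigroups

end Sierpinski

end

theorem corollary4p1 (N : ℕ) (hN : 2 ≤ N) (p : Fin N → EuclideanSpace ℝ (Fin (N - 1)))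
    (hp : ∀ i j, i ≠ j → ‖p i - p j‖ = 1)
    (μ : Measure (Sierpinski.gasket p)) [IsFiniteMeasure μ] [μ.IsOpenPosMeasure]
    (hμ : μ (Sierpinski.boundary p) = 0)
    (B : Fin N → ℝ → ℝ≥0∞)
    (hlsc : ∀ i, LowerSemicontinuous (B i))
    (hmono : ∀ i, Sierpinski.BiMonotone (B i))
    (hnorm : ∀ i, B i 0 = 0)
    (hconv : ConvexOn ℝ≥0 Set.univ (Sierpinski.perturbedEnergy p μ B)) :
    (∃! S, Sierpinski.Generates (Sierpinski.perturbedEnergy p μ B) S) ∧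
    (∃! S, Sierpinski.Generates (Sierpinski.neumannEnergy p μ) S) ∧
    (∃! S, Sierpinski.Generates (Sierpinski.dirichletEnergy p μ) S) ∧
    ∀ S_B S S_inf : Sierpinski.ContractionSemigroup (Lp ℝ 2 μ),
      Sierpinski.Generates (Sierpinski.perturbedEnergy p μ B) S_B →
      Sierpinski.Generates (Sierpinski.neumannEnergy p μ) S →
      Sierpinski.Generates (Sierpinski.dirichletEnergy p μ) S_inf →
      Sierpinski.IsPositive S_B ∧ Sierpinski.OrderPreserving S_B ∧
      Sierpinski.TotallyDominatedBy S_inf S_B ∧ Sierpinski.TotallyDominatedBy S_B S :=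
  Sierpinski.corollary4p1_general (by omega) hp hμ hlsc hmono hnorm hconv
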